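/- Let $\mathcal P=\langle X\mid \mathcal R\rangle$ be a finite presentation such that 1. every relator in $\mathcal R$ has length four and is cyclically reduced; 2. every minimal van Kampen diagram $M$ over $\mathcal P$ (one with the least number of regions among all diagrams with the same boundary label) is a $C(4)\&T(4)$ diagram, i.e. every inner region of $M$ has at least four neighbors and no inner vertex of $M$ has valence three; and every (non-empty) path of $M$ which is on the boundary of two regions is labelled by a single letter of $X^{\pm1}$. (Diagrams are finite, planar, connected and simply connected; each region has a boundary label in the symmetric closure of $\mathcal R$.) A *domino* is a van Kampen diagram over $\mathcal P$ with exactly two regions, boundary of length six and a single inner edge; it is *biased* by the choice of a boundary cycle $\mu$. A biased domino is $3$-typed if the first three edges of $\mu$ lie on one region, $2$-typed if the first two edges but not the first three lie on one region, and $1$-typed if the first two edges do not lie on one region. A domino $M$ is *stable* if for every boundary cycle $\mu$ of $M$ and every biased domino $(M',\mu')$ over $\mathcal P$ such that $\mu'$ has the same label as $\mu$, the biased dominos $(M,\mu)$ and $(M',\mu')$ have the same type. For $x,y,z\in X^{\pm1}$ the triplet $(x,y,z)$ is *stable* if there is a stable domino with cyclically freely reduced boundary label whose boundary cycle contains two consecutive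 edges $e_1,e_2$ labelled $x$ and $y$, such that the terminal vertex of $e_1$ (the initial vertex of $e_2$) has valence three and the inner edge emanating from it is labelled $z$. For $x\in X^{\pm1}$ the *stability graph* $\Gamma_x$ is the directed graph with vertex set $X^{\pm1}$ which has an edge from $y$ to $z$ if and only if $(x,y,z)$ is a stable triplet. Then for every $x\in X^{\pm1}$ the directed graph $\Gamma_x$ has no directed cycles (of any length, loops included). Consequently there is a linear order $<_x$ on $X^{\pm1}$ such that $z<_x y$ whenever $(x,y,z)$ is a stable triplet, and there is a grading function for $x$, i.e. a function $G_x\colon X^{\pm1}\to\{1,\dots,2|X|\}$ such that $G_x(z)<G_x(y)$ whenever $(x,y,z)$ is a stable triplet. -/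

import Mathlib

/-- The set `X^{±1}` of letters: `(x, true)` is the generator `x`, `(x, false)` is `x⁻¹`.
Words are lists of letters, as for `FreeGroup`. -/
abbrev Letter (X : Type*) := X × Bool

/-- The formal inverse of a letter. -/
def Letter.inverse {X : Type*} (a : Letter X) : Letter X := (a.1, !a.2)

/-- All cyclic conjugates of elements of `R` and of their inverses. -/
def symmetricClosure {X : Type*} (R : Set (List (Letter X))) : Set (List (Letter X)) :=
  {w | ∃ r ∈ R, w ~r r ∨ w ~r FreeGroup.invRev r}

/-- A finite connected map on the sphere with at least one edge, one of whose faces is marked as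
the outer face; removing the outer face leaves a finite connected and simply connected planar
2-complex, and every such complex with at least one edge arises in this way. It is encoded as a
combinatorial map: `Dart` is the set of oriented edges, `inv` reverses an oriented edge, and `next`
sends an oriented edge to the one following it on the boundary of the face on its left. Faces are
the orbits of `next`, edges the orbits of `inv`, vertices the orbits of `d ↦ next (inv d)`, which
rotates the oriented edges issuing from a common vertex. The map is spherical when
`V + F = E + 2`. -/
structure PlanarMap where
  Dart : Type
  finite_dart : Finite Dart
  inv : Equiv.Perm Dart
  next : Equiv.Perm Dart
  inv_inv : ∀ d, inv (inv d) = d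
  inv_ne : ∀ d, inv d ≠ d
  connected : ∀ d d', Relation.EqvGen (fun a b => b = inv a ∨ b = next a) d d'
  euler : Nat.card (Quotient (Equiv.Perm.SameCycle.setoid (next * inv)))
      + Nat.card (Quotient (Equiv.Perm.SameCycle.setoid next))
      = Nat.card (Quotient (Equiv.Perm.SameCycle.setoid inv)) + 2
  outer : Quotient (Equiv.Perm.SameCycle.setoid next)

namespace PlanarMap

variable (M : PlanarMap)

/-- Vertices. -/
def Vertex : Type := Quotient (Equiv.Perm.SameCycle.setoid (M.next * M.inv))

/-- Non-oriented edges. -/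
def Edge : Type := Quotient (Equiv.Perm.SameCycle.setoid M.inv)

/-- Faces of the spherical map, including the outer one. -/
def Face : Type := Quotient (Equiv.Perm.SameCycle.setoid M.next)

/-- The outer face. -/
def outerFace : M.Face := M.outer

/-- The initial vertex `i(d)` of an oriented edge. -/
def origin (d : M.Dart) : M.Vertex := Quotient.mk _ d

/-- The non-oriented edge underlying an oriented one. -/
def edge (d : M.Dart) : M.Edge := Quotient.mk _ d

/-- The face on the left of an oriented edge. -/
def face (d : M.Dart) : M.Face := Quotient.mk _ d

/-- Regions are the faces other than the outer one. -/
def Region : Type := {D : M.Face // D ≠ M.outerFace}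

/-- The number of regions. -/
noncomputable def numRegions : ℕ := Nat.card M.Region

/-- The closed path around the face on the left of `d`, starting with `d`. -/
noncomputable def faceWalk (d : M.Dart) : List M.Dart :=
  List.iterate M.next d (Function.minimalPeriod M.next d)

/-- The edge of `d` lies on the boundary of the map. -/
def IsBoundaryEdge (d : M.Dart) : Prop :=
  M.face d = M.outerFace ∨ M.face (M.inv d) = M.outerFace

/-- The edge of `d` is an inner edge. -/
def IsInnerEdge (d : M.Dart) : Prop := ¬ M.IsBoundaryEdge d

/-- A vertex on the boundary of the map. -/
def IsBoundaryVertex (v : M.Vertex) : Prop := ∃ d, M.origin d = v ∧ M.face d = M.outerFace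

/-- The number of oriented edges issuing from `v` (so a loop counts twice). -/
noncomputable def valence (v : M.Vertex) : ℕ := {d | M.origin d = v}.ncard

/-- A region whose boundary shares no edge with the boundary of the map. -/
def IsInnerRegion (D : M.Region) : Prop :=
  ∀ d, M.face d = D.1 → M.face (M.inv d) ≠ M.outerFace

/-- Two different regions whose boundaries share an edge. -/
def Neighbors (D D' : M.Region) : Prop :=
  D ≠ D' ∧ ∃ d, M.face d = D.1 ∧ M.face (M.inv d) = D'.1

/-- The `C(4) & T(4)` maps: every inner region has at least four neighbors and no inner vertex has
valence three. -/
def IsC4T4 : Prop :=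
  (∀ D : M.Region, M.IsInnerRegion D → 4 ≤ {D' | M.Neighbors D D'}.ncard) ∧
  (∀ v : M.Vertex, ¬ M.IsBoundaryVertex v → M.valence v ≠ 3)

/-- `d` is the first edge of a boundary cycle of the map, namely of `M.faceWalk d`. (Boundary cycles
in the opposite direction are the boundary cycles of the mirror image of the map.) -/
def StartsBoundaryCycle (d : M.Dart) : Prop := M.face d = M.outerFace

/-- The path `ρ` is a sub-path of the boundary cycle of the face `D`, which is on its left. -/
def IsSubpathOfBoundary (ρ : List M.Dart) (D : M.Face) : Prop :=
  (∀ d ∈ ρ, M.face d = D) ∧ ρ.IsChain (fun a b => M.next a = b)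

/-- The reversed path. -/
def reversePath (ρ : List M.Dart) : List M.Dart := (ρ.map M.inv).reverse

/-- The path `ρ` is on the boundary of the two different regions `D` and `D'`. -/
def IsOnBoundaryOfTwo (ρ : List M.Dart) (D D' : M.Region) : Prop :=
  D ≠ D' ∧ M.IsSubpathOfBoundary ρ D.1 ∧ M.IsSubpathOfBoundary (M.reversePath ρ) D'.1

/-- The region containing the `i`-th edge (counted from `0`) of the boundary cycle starting with
`d`. -/
def regionAt (d : M.Dart) (i : ℕ) : M.Face := M.face (M.inv (M.next^[i] d))

/-- There are two regions, the boundary has length six and there is a single inner edge. -/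
def IsDomino : Prop :=
  M.numRegions = 2 ∧
  (∀ d, M.StartsBoundaryCycle d → (M.faceWalk d).length = 6) ∧
  {e : M.Edge | ∃ d, M.edge d = e ∧ M.IsInnerEdge d}.ncard = 1

open Classical in
/-- The type (`1`, `2` or `3`) of a domino biased through the boundary cycle starting with `d`:
`3` if the first three edges lie on one region, `2` if the first two edges but not the first three
lie on one region, and `1` if the first two edges do not lie on one region. -/
noncomputable def dominoType (d : M.Dart) : ℕ :=
  if M.regionAt d 0 = M.regionAt d 1 then
    if M.regionAt d 1 = M.regionAt d 2 then 3 else 2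
  else 1

end PlanarMap

/-- A van Kampen diagram over the presentation `⟨X | R⟩`, each edge labelled by a letter. -/
structure VanKampenDiagram {X : Type*} (R : Set (List (Letter X))) extends PlanarMap where
  label : Dart → Letter X
  label_inv : ∀ d, label (inv d) = (label d).inverse
  label_region : ∀ d, toPlanarMap.face d ≠ toPlanarMap.outerFace →
    (toPlanarMap.faceWalk d).map label ∈ symmetricClosure R

namespace VanKampenDiagram

variable {X : Type*} {R : Set (List (Letter X))}

/-- The label of the boundary cycle starting with `d`. -/
noncomputable def boundaryLabel (M : VanKampenDiagram R) (d : M.Dart) : List (Letter X) :=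
  (M.faceWalk d).map M.label

/-- No diagram with the same boundary label has fewer regions. -/
def IsMinimal (M : VanKampenDiagram R) : Prop :=
  ∀ d, M.StartsBoundaryCycle d →
    ∀ (M' : VanKampenDiagram R) (d' : M'.Dart), M'.StartsBoundaryCycle d' →
      M'.boundaryLabel d' = M.boundaryLabel d → M.numRegions ≤ M'.numRegions

/-- Every (non-empty) path on the boundary of two regions is labelled by a single letter. -/
def TwoRegionPathsAreLetters (M : VanKampenDiagram R) : Prop :=
  ∀ (ρ : List M.Dart) (D D' : M.Region), ρ ≠ [] → M.IsOnBoundaryOfTwo ρ D D' →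
    ∃ a : Letter X, ρ.map M.label = [a]

/-- A domino such that every biased domino with the same boundary label has the same type. -/
def IsStableDomino (M : VanKampenDiagram R) : Prop :=
  M.IsDomino ∧ ∀ d, M.StartsBoundaryCycle d →
    ∀ (M' : VanKampenDiagram R) (d' : M'.Dart), M'.IsDomino → M'.StartsBoundaryCycle d' →
      M'.boundaryLabel d' = M.boundaryLabel d → M'.dominoType d' = M.dominoType d

end VanKampenDiagram

/-- `(x, y, z)` is a stable triplet: some stable domino with (cyclically) freely reduced boundary
label has consecutive boundary edges `e₁`, `e₂` labelled `x`, `y`, the vertex between them has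
valence three, and the inner edge `e₃` emanating from it is labelled `z`. -/
def IsStableTriplet {X : Type*} (R : Set (List (Letter X))) (x y z : Letter X) : Prop :=
  ∃ (N : VanKampenDiagram R) (e₁ e₂ e₃ : N.Dart),
    N.IsStableDomino ∧ N.StartsBoundaryCycle e₁ ∧
    FreeGroup.IsCyclicallyReduced (N.boundaryLabel e₁) ∧
    e₂ = N.next e₁ ∧ N.valence (N.origin e₂) = 3 ∧
    N.origin e₃ = N.origin e₂ ∧ N.IsInnerEdge e₃ ∧
    N.label e₁ = x ∧ N.label e₂ = y ∧ N.label e₃ = z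

/-- The stability graph `Γ_x`: an edge from `y` to `z` for each stable triplet `(x, y, z)`. -/
def stabilityGraph {X : Type*} (R : Set (List (Letter X))) (x : Letter X) : Digraph (Letter X) where
  Adj y z := IsStableTriplet R x y z

/-- There is no closed directed walk of positive length. -/
def Digraph.IsCycleFree {V : Type*} (Γ : Digraph V) : Prop :=
  ∀ v, ¬ Relation.TransGen Γ.Adj v v

/-- A grading function `G_x : X^{±1} → {1, …, 2|X|}` for `x`. -/
def IsGradingFunction {X : Type*} [Fintype X] (R : Set (List (Letter X))) (x : Letter X)
    (G : Letter X → ℕ) : Prop :=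
  (∀ y, 1 ≤ G y ∧ G y ≤ 2 * Fintype.card X) ∧
  ∀ y z, IsStableTriplet R x y z → G z < G y

/-!
Write `Q y` for the set of letters `a` for which some relator of the form `x y b a` exists. The
stability graph has no cycles because `Q` increases strictly along its edges
(`IsStableTriplet.closingLetters_ssubset`).

Let `(x, y, z)` be stable, with squares `x z b₁ a₁` and `z⁻¹ y c d`; the hexagon `x y c d b₁ a₁`
can be cut into two squares in only one of the three possible ways. If `x y b a` is a relator, it
surrounds a vertex of valence three together with these two squares. That diagram violates `T(4)`,
so the hexagon `a⁻¹ b⁻¹ c d b₁ a₁` is filled by at most two squares, and, unless it is degenerate,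
they form a domino (`exists_split_of_three_squares`). Two squares that share a path of length two
violate the condition on common paths, so they can be replaced by one square
(`IsSquareRelator.glue`). Combined with `x y b a`, two of the three positions of the inner edge of
the domino give a forbidden cut of the stable hexagon; in the third one, a square shares `b₁ a₁`
with `x z b₁ a₁`, and gluing yields a relator `x z t a`. Hence `Q y ⊆ Q z`. Moreover `a₁ ∈ Q z`,
whereas `a₁ ∈ Q y` would again produce a forbidden cut.

Diagrams with at most two regions are classified by counting bends, the darts at vertices of
valence greater than two. By Euler's formula a map without vertices of valence one has at most
`6 (r - 1)` bends, where `r` is the number of regions (`PlanarMap.ncard_not_isStraight_le`). For one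
region there are none, so that the boundary is a relator. For two squares and a boundary of length
six there are at most six; each square takes at least two of them, and the remaining two cut
the boundary into halves (`PlanarMap.IsHexagonOfTwoSquares.exists_splitsAt`). The diagrams to be replaced are
given explicitly, as permutations of finite sets of darts.
-/

/-! ### Counting bends in a spherical map -/

open Classical in
/-- For a permutation without fixed points, the points lying on orbits of length greater than two
are few when there are many orbits: an orbit of length `l ≥ 3` satisfies `l ≤ 3 (l - 2)`. -/
theorem Equiv.Perm.ncard_sq_ne_add_le {D : Type*} [Finite D] (π : Equiv.Perm D)
    (hπ : ∀ d, π d ≠ d) :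
    {d | π (π d) ≠ d}.ncard + 6 * Nat.card (Quotient (Equiv.Perm.SameCycle.setoid π))
      ≤ 3 * Nat.card D := by
  cases nonempty_fintype D
  let q : D → Quotient (Equiv.Perm.SameCycle.setoid π) := Quotient.mk _
  have hq : ∀ d, q (π d) = q d := fun d =>
    Quotient.sound (Equiv.Perm.sameCycle_apply_left.2 (Equiv.Perm.SameCycle.refl π d))
  have : Fintype (Quotient (Equiv.Perm.SameCycle.setoid π)) := Fintype.ofFinite _
  rw [Set.ncard_eq_toFinset_card', Nat.card_eq_fintype_card, Nat.card_eq_fintype_card,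
    ← Finset.card_univ (α := D), ← Finset.card_univ (α := Quotient _),
    Finset.card_eq_sum_card_fiberwise (f := q) (t := Finset.univ) (by simp),
    Finset.card_eq_sum_card_fiberwise (s := (Finset.univ : Finset D)) (f := q)
      (t := Finset.univ) (by simp),
    Finset.card_eq_sum_ones, Finset.mul_sum, Finset.mul_sum, ← Finset.sum_add_distrib]
  refine Finset.sum_le_sum fun v _ => ?_
  obtain ⟨d, rfl⟩ := Quotient.exists_rep v
  change _ ≤ 3 * (Finset.univ.filter fun e => q e = q d).card
  set f := Finset.univ.filter fun e => q e = q d with hf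
  have h2 : 2 ≤ f.card := by
    rw [← Finset.card_pair (hπ d)]
    apply Finset.card_le_card
    intro e
    simp only [Finset.mem_insert, Finset.mem_singleton, hf, Finset.mem_filter, Finset.mem_univ,
      true_and]
    rintro (rfl | rfl) <;> simp [hq]
  have hsub : ({e ∈ {d | π (π d) ≠ d}.toFinset | q e = Quotient.mk _ d} : Finset D) ⊆ f := by
    intro e
    simp [hf, q]
  have h3 := Finset.card_le_card hsub
  rcases h2.lt_or_eq with h | h
  · omega
  · have : ({e ∈ {d | π (π d) ≠ d}.toFinset | q e = Quotient.mk _ d} : Finset D) = ∅ := by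
      apply Finset.eq_empty_of_forall_notMem
      intro e he
      have hne : π (π e) ≠ e := by simpa using (Finset.mem_filter.1 he).1
      have hef : e ∈ f := hsub he
      have hed : q e = q d := (Finset.mem_filter.1 hef).2
      have h3 : ({e, π e, π (π e)} : Finset D).card = 3 :=
        Finset.card_eq_three.2 ⟨_, _, _, (hπ e).symm, hne.symm, (hπ (π e)).symm, rfl⟩
      have : ({e, π e, π (π e)} : Finset D) ⊆ f := by
        intro x
        simp only [Finset.mem_insert, Finset.mem_singleton, hf, Finset.mem_filter,
          Finset.mem_univ, true_and]
        rintro (rfl | rfl | rfl) <;> simp [hq, hed]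
      have := Finset.card_le_card this
      omega
    rw [this, Finset.card_empty]
    omega

theorem Equiv.Perm.card_le_two_mul_card_orbits {D : Type*} [Finite D] (π : Equiv.Perm D)
    (hπ : ∀ d, π (π d) = d) :
    Nat.card D ≤ 2 * Nat.card (Quotient (Equiv.Perm.SameCycle.setoid π)) := by
  classical
  cases nonempty_fintype D
  let q : D → Quotient (Equiv.Perm.SameCycle.setoid π) := Quotient.mk _
  have : Fintype (Quotient (Equiv.Perm.SameCycle.setoid π)) := Fintype.ofFinite _
  rw [Nat.card_eq_fintype_card, Nat.card_eq_fintype_card,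
    ← Finset.card_univ (α := D), ← Finset.card_univ (α := Quotient _)]
  refine Finset.card_le_mul_card_image_of_maps_to (f := q) (fun _ _ => Finset.mem_univ _) 2
    fun v _ => ?_
  obtain ⟨d, rfl⟩ := Quotient.exists_rep v
  refine (Finset.card_le_card (t := {d, π d}) fun e he => ?_).trans Finset.card_le_two
  have h : q e = q d := by simpa using he
  obtain ⟨n, rfl⟩ := (Quotient.exact h.symm : π.SameCycle d e).exists_nat_pow_eq
  clear he h
  induction n with
  | zero => simp
  | succ n ih =>
    rw [pow_succ', Equiv.Perm.mul_apply]
    simp only [Finset.mem_insert, Finset.mem_singleton] at ih ⊢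
    rcases ih with ih | ih <;> simp [ih, hπ]

namespace PlanarMap

variable (M : PlanarMap)

instance : Finite M.Dart := M.finite_dart

instance : Finite M.Face := inferInstanceAs (Finite (Quotient _))

theorem face_next (d : M.Dart) : M.face (M.next d) = M.face d :=
  Quotient.sound (Equiv.Perm.sameCycle_apply_left.2 (Equiv.Perm.SameCycle.refl M.next d))

theorem face_next_iterate (d : M.Dart) (k : ℕ) : M.face (M.next^[k] d) = M.face d := by
  induction k with
  | zero => rfl
  | succ k ih => rw [Function.iterate_succ_apply', face_next, ih]

theorem exists_iterate_eq_of_origin_eq {d e : M.Dart} (h : M.origin d = M.origin e) :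
    ∃ k : ℕ, (M.next * M.inv)^[k] d = e := by
  obtain ⟨n, hn⟩ := (Quotient.exact h : (M.next * M.inv).SameCycle d e).exists_nat_pow_eq
  exact ⟨n, by rwa [Equiv.Perm.iterate_eq_pow]⟩

theorem next_mem_periodicPts (d : M.Dart) : d ∈ Function.periodicPts M.next :=
  M.next.injective.mem_periodicPts d

theorem minimalPeriod_next_pos (d : M.Dart) : 0 < Function.minimalPeriod M.next d :=
  Function.minimalPeriod_pos_of_mem_periodicPts (M.next_mem_periodicPts d)

theorem exists_iterate_eq_of_face_eq {d e : M.Dart} (h : M.face d = M.face e) :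
    ∃ k < Function.minimalPeriod M.next d, M.next^[k] d = e := by
  obtain ⟨n, hn⟩ := (Quotient.exact h : M.next.SameCycle d e).exists_nat_pow_eq
  refine ⟨n % Function.minimalPeriod M.next d, Nat.mod_lt _ (M.minimalPeriod_next_pos d), ?_⟩
  rw [Function.iterate_mod_minimalPeriod_eq, Equiv.Perm.iterate_eq_pow, hn]

theorem mem_faceWalk {d e : M.Dart} : e ∈ M.faceWalk d ↔ M.face e = M.face d := by
  rw [faceWalk, List.mem_iterate]
  constructor
  · rintro ⟨m, -, rfl⟩
    exact M.face_next_iterate d m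
  · intro h
    obtain ⟨k, hk, rfl⟩ := M.exists_iterate_eq_of_face_eq h.symm
    exact ⟨k, hk, rfl⟩

theorem length_faceWalk (d : M.Dart) :
    (M.faceWalk d).length = Function.minimalPeriod M.next d := List.length_iterate ..

theorem nodup_faceWalk (d : M.Dart) : (M.faceWalk d).Nodup := by
  rw [faceWalk, ← List.range_map_iterate]
  refine List.Nodup.map_on (fun a ha b hb h => ?_) List.nodup_range
  exact Function.iterate_injOn_Iio_minimalPeriod (by simpa using ha) (by simpa using hb) h

theorem next_iterate_length_faceWalk (d : M.Dart) :
    M.next^[(M.faceWalk d).length] d = d := by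
  rw [length_faceWalk]
  exact Function.iterate_minimalPeriod

theorem faceWalk_next (d : M.Dart) : M.faceWalk (M.next d) = (M.faceWalk d).rotate 1 := by
  have h : Function.minimalPeriod M.next (M.next d) = Function.minimalPeriod M.next d :=
    Function.minimalPeriod_apply (M.next_mem_periodicPts d)
  obtain ⟨n, hn⟩ := Nat.exists_eq_succ_of_ne_zero (M.minimalPeriod_next_pos d).ne'
  have hd : M.next^[n] (M.next d) = d := by
    rw [← Function.iterate_succ_apply, ← hn]
    exact Function.iterate_minimalPeriod
  rw [faceWalk, faceWalk, h, hn, Nat.succ_eq_add_one, List.iterate_add, add_comm n 1,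
    List.iterate_add]
  simp [List.iterate, hd]

theorem faceWalk_iterate (d : M.Dart) (k : ℕ) :
    M.faceWalk (M.next^[k] d) = (M.faceWalk d).rotate k := by
  induction k with
  | zero => simp
  | succ k ih => rw [Function.iterate_succ_apply', faceWalk_next, ih, List.rotate_rotate]

theorem card_face : Nat.card M.Face = M.numRegions + 1 := by
  classical
  have h := Set.ncard_add_ncard_compl {M.outerFace}
  rw [Set.ncard_singleton] at h
  rw [numRegions, ← h, add_comm]
  rfl

/-- A set of faces that is closed under adjacency and non-empty contains every face. -/
theorem forall_face_of_adjacent {Q : M.Face → Prop}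
    (hQ : ∀ d, Q (M.face d) → Q (M.face (M.inv d))) {d₀ : M.Dart} (h₀ : Q (M.face d₀))
    (F : M.Face) : Q F := by
  obtain ⟨d, rfl⟩ := Quotient.exists_rep F
  have key : ∀ a b, Relation.EqvGen (fun a b => b = M.inv a ∨ b = M.next a) a b →
      (Q (M.face a) ↔ Q (M.face b)) := by
    intro a b h
    induction h with
    | rel a b h =>
      rcases h with rfl | rfl
      · exact ⟨hQ a, fun h => by simpa [M.inv_inv] using hQ _ h⟩
      · rw [face_next]
    | refl a => rfl
    | symm a b _ ih => exact ih.symm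
    | trans a b c _ _ ih₁ ih₂ => exact ih₁.trans ih₂
  exact (key d₀ d (M.connected d₀ d)).1 h₀

/-- The vertex at which `d` begins has valence at most two: turning twice around it leads back to
`d`. -/
def IsStraight (d : M.Dart) : Prop := M.next (M.inv (M.next (M.inv d))) = d

theorem isStraight_next_iff {d : M.Dart} :
    M.IsStraight (M.next d) ↔ M.next (M.inv (M.next d)) = M.inv d := by
  rw [IsStraight, M.next.injective.eq_iff]
  constructor
  · intro h
    rw [← M.inv_inv (M.next (M.inv (M.next d))), h]
  · intro h
    rw [h, M.inv_inv]

/-- Euler's formula bounds the number of bends of a map without vertices of valence one by six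
times the number of regions beyond the first. -/
theorem ncard_not_isStraight_le (hleaf : ∀ d, M.next d ≠ M.inv d) :
    {d | ¬ M.IsStraight d}.ncard + 6 ≤ 6 * M.numRegions := by
  have h₁ := Equiv.Perm.ncard_sq_ne_add_le (M.next * M.inv) (fun d h => by
    have := hleaf (M.inv d)
    rw [M.inv_inv] at this
    exact this h)
  have h₂ := Equiv.Perm.card_le_two_mul_card_orbits M.inv M.inv_inv
  have h₃ := M.euler
  have h₄ : Nat.card (Quotient (Equiv.Perm.SameCycle.setoid M.next)) = M.numRegions + 1 :=
    M.card_face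
  have h₅ : {d | ¬ M.IsStraight d} = {d | (M.next * M.inv) ((M.next * M.inv) d) ≠ d} := rfl
  rw [h₅]
  omega

end PlanarMap

/-! ### Hexagons filled by two squares -/

namespace PlanarMap

variable (M : PlanarMap)

theorem faceWalk_eq_of_length_four {d : M.Dart} (h : (M.faceWalk d).length = 4) :
    M.faceWalk d = [d, M.next d, M.next (M.next d), M.next (M.next (M.next d))] := by
  rw [length_faceWalk] at h
  rw [faceWalk, h]
  rfl

theorem faceWalk_eq_of_length_six {d : M.Dart} (h : (M.faceWalk d).length = 6) :
    M.faceWalk d = [d, M.next d, M.next (M.next d), M.next (M.next (M.next d)),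
      M.next (M.next (M.next (M.next d))), M.next (M.next (M.next (M.next (M.next d))))] := by
  rw [length_faceWalk] at h
  rw [faceWalk, h]
  rfl

/-- Two square regions, boundary of length six, and no vertex of valence one. -/
structure IsHexagonOfTwoSquares : Prop where
  numRegions_eq : M.numRegions = 2
  next_ne_inv : ∀ d, M.next d ≠ M.inv d
  length_outer : ∀ d, M.face d = M.outerFace → (M.faceWalk d).length = 6
  length_region : ∀ d, M.face d ≠ M.outerFace → (M.faceWalk d).length = 4

/-- The map is a domino whose inner edge issues from the beginning of `o`: the boundary cycle
starting with `o` has its first three edges on one square and its last three edges on another one,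
and the two squares share the edge of `M.next (M.inv o)`. -/
structure SplitsAt (o : M.Dart) : Prop where
  left₁ : M.next (M.inv (M.next (M.next o))) = M.inv (M.next o)
  left₂ : M.next (M.inv (M.next o)) = M.inv o
  left₃ : M.next (M.next (M.inv o)) = M.inv (M.next (M.next o))
  right₁ : M.next (M.inv (M.next (M.next (M.next (M.next (M.next o)))))) =
    M.inv (M.next (M.next (M.next (M.next o))))
  right₂ : M.next (M.inv (M.next (M.next (M.next (M.next o))))) =
    M.inv (M.next (M.next (M.next o)))
  right₃ : M.next (M.inv (M.next (M.next (M.next o)))) = M.inv (M.next (M.inv o))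
  right₄ : M.next (M.inv (M.next (M.inv o))) =
    M.inv (M.next (M.next (M.next (M.next (M.next o)))))
  left_ne_outer : M.face (M.inv o) ≠ M.outerFace
  right_ne_outer : M.face (M.inv (M.next (M.next (M.next o)))) ≠ M.outerFace
  left_ne_right : M.face (M.inv o) ≠ M.face (M.inv (M.next (M.next (M.next o))))

namespace IsHexagonOfTwoSquares

variable {M}

theorem region_cycle (h : M.IsHexagonOfTwoSquares) {a a₁ a₂ a₃ : M.Dart}
    (ha : M.face a ≠ M.outerFace) (h₁ : M.next a = a₁) (h₂ : M.next a₁ = a₂)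
    (h₃ : M.next a₂ = a₃) :
    M.next a₃ = a ∧ (a ≠ a₁ ∧ a ≠ a₂ ∧ a ≠ a₃ ∧ a₁ ≠ a₂ ∧ a₁ ≠ a₃ ∧ a₂ ≠ a₃) ∧
    ∀ e, M.face e = M.face a → e = a ∨ e = a₁ ∨ e = a₂ ∨ e = a₃ := by
  have hl := h.length_region a ha
  have hw := M.faceWalk_eq_of_length_four hl
  have h4 := M.next_iterate_length_faceWalk a
  have hnd := M.nodup_faceWalk a
  have hmem := fun e => M.mem_faceWalk (d := a) (e := e)
  rw [hl] at h4
  simp only [Function.iterate_succ_apply, Function.iterate_zero_apply] at h4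
  rw [h₁, h₂, h₃] at hw h4
  refine ⟨h4, ?_, fun e he => ?_⟩
  · simpa [hw, and_assoc] using hnd
  · simpa [hw] using (hmem e).2 he

theorem outer_cycle (h : M.IsHexagonOfTwoSquares) {o o₁ o₂ o₃ o₄ o₅ : M.Dart}
    (ho : M.face o = M.outerFace) (h₁ : M.next o = o₁) (h₂ : M.next o₁ = o₂)
    (h₃ : M.next o₂ = o₃) (h₄ : M.next o₃ = o₄) (h₅ : M.next o₄ = o₅) :
    M.next o₅ = o ∧ (o ≠ o₁ ∧ o ≠ o₂ ∧ o ≠ o₃ ∧ o ≠ o₄ ∧ o ≠ o₅ ∧ o₁ ≠ o₂ ∧ o₁ ≠ o₃ ∧ o₁ ≠ o₄ ∧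
      o₁ ≠ o₅ ∧ o₂ ≠ o₃ ∧ o₂ ≠ o₄ ∧ o₂ ≠ o₅ ∧ o₃ ≠ o₄ ∧ o₃ ≠ o₅ ∧ o₄ ≠ o₅) ∧
    ∀ e, M.face e = M.outerFace → e = o ∨ e = o₁ ∨ e = o₂ ∨ e = o₃ ∨ e = o₄ ∨ e = o₅ := by
  have hl := h.length_outer o ho
  have hw := M.faceWalk_eq_of_length_six hl
  have h6 := M.next_iterate_length_faceWalk o
  have hnd := M.nodup_faceWalk o
  have hmem := fun e => M.mem_faceWalk (d := o) (e := e)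
  rw [hl] at h6
  simp only [Function.iterate_succ_apply, Function.iterate_zero_apply] at h6
  rw [h₁, h₂, h₃, h₄, h₅] at hw h6
  refine ⟨h6, ?_, fun e he => ?_⟩
  · simpa [hw, and_assoc] using hnd
  · simpa [hw] using (hmem e).2 (he.trans ho.symm)

theorem face_trichotomy (h : M.IsHexagonOfTwoSquares) {A B : M.Face} (hA : A ≠ M.outerFace)
    (hB : B ≠ M.outerFace) (hAB : A ≠ B) (F : M.Face) : F = M.outerFace ∨ F = A ∨ F = B := by
  by_contra! hF
  have := M.card_face
  rw [h.numRegions_eq] at this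
  have h4 : ({F, M.outerFace, A, B} : Set M.Face).ncard = 4 := by
    classical
    have : ({F, M.outerFace, A, B} : Set M.Face) =
      (({F, M.outerFace, A, B} : Finset M.Face) : Set M.Face) := by simp
    rw [this, Set.ncard_coe_finset, Finset.card_eq_of_equiv_fin]
    refine (Fintype.equivFinOfCardEq ?_)
    rw [Fintype.card_coe, Finset.card_insert_of_notMem, Finset.card_eq_three.2
      ⟨_, _, _, hA.symm, hB.symm, hAB, rfl⟩]
    simp [hF.1, hF.2.1, hF.2.2]
  have := Set.ncard_le_card ({F, M.outerFace, A, B} : Set M.Face)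
  omega

/-- By the bound on the number of bends, there are six of them at most. -/
theorem false_of_seven_bends (h : M.IsHexagonOfTwoSquares) (l : List M.Dart) (hl : l.Nodup)
    (h7 : 7 ≤ l.length) (hb : ∀ d ∈ l, ¬ M.IsStraight d) : False := by
  classical
  have h₁ := M.ncard_not_isStraight_le h.next_ne_inv
  rw [h.numRegions_eq] at h₁
  have h₂ : (l.toFinset : Set M.Dart).ncard ≤ {d | ¬ M.IsStraight d}.ncard :=
    Set.ncard_le_ncard (by intro d hd; exact hb d (by simpa using hd))
  rw [Set.ncard_coe_finset, List.toFinset_card_of_nodup hl] at h₂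
  omega

/-- Every region bends at two vertices at least. -/
theorem exists_bend_of_region (h : M.IsHexagonOfTwoSquares) {a a₁ a₂ a₃ : M.Dart}
    (ha : M.face a ≠ M.outerFace) (h₁ : M.next a = a₁) (h₂ : M.next a₁ = a₂)
    (h₃ : M.next a₂ = a₃) :
    ¬ (M.IsStraight a₁ ∧ M.IsStraight a₂ ∧ M.IsStraight a₃) := by
  rintro ⟨s₁, s₂, s₃⟩
  obtain ⟨a4, and, acov⟩ := h.region_cycle ha h₁ h₂ h₃
  rw [← h₁, isStraight_next_iff, h₁] at s₁
  rw [← h₂, isStraight_next_iff, h₂] at s₂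
  rw [← h₃, isStraight_next_iff, h₃] at s₃
  have fa₁ : M.face a₁ = M.face a := h₁ ▸ M.face_next a
  have fa₂ : M.face a₂ = M.face a := h₂ ▸ (M.face_next a₁).trans fa₁
  have fa₃ : M.face a₃ = M.face a := h₃ ▸ (M.face_next a₂).trans fa₂
  obtain ⟨o, e₃⟩ : ∃ o, M.inv a₃ = o := ⟨_, rfl⟩
  obtain ⟨o₁, e₂⟩ : ∃ o, M.inv a₂ = o := ⟨_, rfl⟩
  obtain ⟨o₂, e₁⟩ : ∃ o, M.inv a₁ = o := ⟨_, rfl⟩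
  obtain ⟨o₃, e₀⟩ : ∃ o, M.inv a = o := ⟨_, rfl⟩
  have ia : M.inv o₃ = a := by rw [← e₀, M.inv_inv]
  have ia₁ : M.inv o₂ = a₁ := by rw [← e₁, M.inv_inv]
  have ia₂ : M.inv o₁ = a₂ := by rw [← e₂, M.inv_inv]
  have ia₃ : M.inv o = a₃ := by rw [← e₃, M.inv_inv]
  rw [e₁, e₀] at s₁
  rw [e₂, e₁] at s₂
  rw [e₃, e₂] at s₃
  have fo₁ : M.face o₁ = M.face o := s₃ ▸ M.face_next o
  have fo₂ : M.face o₂ = M.face o := s₂ ▸ (M.face_next o₁).trans fo₁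
  have fo₃ : M.face o₃ = M.face o := s₁ ▸ (M.face_next o₂).trans fo₂
  by_cases hF : M.face o = M.outerFace
  · -- The square then has all its edges on the boundary of the map, and the other square has two
    -- of its own edges identified; all four corners of the latter are bends.
    obtain ⟨o₄, h₄⟩ : ∃ o₄, M.next o₃ = o₄ := ⟨_, rfl⟩
    obtain ⟨o₅, h₅⟩ : ∃ o₅, M.next o₄ = o₅ := ⟨_, rfl⟩
    obtain ⟨o6, ond, ocov⟩ := h.outer_cycle hF s₃ s₂ s₁ h₄ h₅
    have fo₄ : M.face o₄ = M.outerFace := by rw [← h₄, face_next, fo₃, hF]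
    have fo₅ : M.face o₅ = M.outerFace := by rw [← h₅, face_next, fo₄]
    obtain ⟨p, hp⟩ : ∃ p, M.inv o₄ = p := ⟨_, rfl⟩
    obtain ⟨q, hq⟩ : ∃ q, M.inv o₅ = q := ⟨_, rfl⟩
    have hl₄ : o₅ ≠ p := h₅ ▸ hp ▸ h.next_ne_inv o₄
    have hin₄ : p ≠ o₄ := hp ▸ M.inv_ne o₄
    have hin₅ : q ≠ o₅ := hq ▸ M.inv_ne o₅
    have ip : M.inv p = o₄ := by rw [← hp, M.inv_inv]
    have iq : M.inv q = o₅ := by rw [← hq, M.inv_inv]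
    -- The other side of an edge outside the square lies on the other square.
    have houter : ∀ r s, M.inv r = s → M.inv s = r → M.face s = M.outerFace →
        r = a ∨ r = a₁ ∨ r = a₂ ∨ r = a₃ ∨ r = p ∨ r = q := by
      intro r s hrs hsr hs
      have := ocov s hs
      clear acov ocov
      grind
    have hleft : ∀ r s, M.inv r = s → M.inv s = r → M.face s = M.face a →
        r = o ∨ r = o₁ ∨ r = o₂ ∨ r = o₃ := by
      intro r s hrs hsr hs
      have := acov s hs
      clear acov ocov
      grind
    have fp : M.face p ≠ M.outerFace := by
      intro hh
      have := ocov p hh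
      clear acov ocov houter hleft
      grind
    have fq : M.face q ≠ M.outerFace := by
      intro hh
      have := ocov q hh
      clear acov ocov houter hleft
      grind
    have fpa : M.face p ≠ M.face a := by
      intro hh
      have := acov p hh
      clear acov ocov houter hleft
      grind
    have fqa : M.face q ≠ M.face a := by
      intro hh
      have := acov q hh
      clear acov ocov houter hleft
      grind
    have fqp : M.face q = M.face p := by
      rcases h.face_trichotomy ha fp fpa.symm (M.face q) with hh | hh | hh
      · exact (fq hh).elim
      · exact (fqa hh).elim
      · exact hh
    have hself : ∀ r, M.face r = M.face p → r ≠ p → r ≠ q → M.face (M.inv r) = M.face p := by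
      intro r hr hrp hrq
      rcases h.face_trichotomy ha fp fpa.symm (M.face (M.inv r)) with hh | hh | hh
      · have := houter r _ rfl (M.inv_inv r) hh
        clear acov ocov houter hleft
        grind
      · have := hleft r _ rfl (M.inv_inv r) hh
        clear acov ocov houter hleft
        grind
      · exact hh
    clear acov ocov houter hleft
    obtain ⟨p₁, k₁⟩ : ∃ p₁, M.next p = p₁ := ⟨_, rfl⟩
    obtain ⟨p₂, k₂⟩ : ∃ p₂, M.next p₁ = p₂ := ⟨_, rfl⟩
    obtain ⟨p₃, k₃⟩ : ∃ p₃, M.next p₂ = p₃ := ⟨_, rfl⟩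
    obtain ⟨p4, pnd, pcov⟩ := h.region_cycle fp k₁ k₂ k₃
    have fp₁ : M.face p₁ = M.face p := k₁ ▸ M.face_next p
    have fp₂ : M.face p₂ = M.face p := k₂ ▸ (M.face_next _).trans fp₁
    have fp₃ : M.face p₃ = M.face p := k₃ ▸ (M.face_next _).trans fp₂
    have hl₁ := h.next_ne_inv p₁
    have hl₂ := h.next_ne_inv p₂
    have hi₁ := M.inv_ne p₁
    have hi₂ := M.inv_ne p₂
    have hii₁ := M.inv_inv p₁
    have hii₂ := M.inv_inv p₂
    have hq2 : q = p₂ := by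
      rcases pcov q fqp with hh | hh | hh | hh
      · clear pcov hself
        grind
      · have h1 := pcov _ (hself p₂ fp₂ (by grind) (by grind))
        clear pcov hself
        grind
      · exact hh
      · have h1 := pcov _ (hself p₁ fp₁ (by grind) (by grind))
        clear pcov hself
        grind
    have hp13 : M.inv p₁ = p₃ := by
      have h1 := pcov _ (hself p₁ fp₁ (by grind) (by grind))
      clear pcov hself
      grind
    clear pcov hself
    refine h.false_of_seven_bends [o, o₄, o₅, a, p, p₁, p₂] ?_ (by simp) ?_
    · simp only [List.nodup_cons, List.mem_cons, List.not_mem_nil, or_false, not_or,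
        List.nodup_nil, not_false_eq_true, and_true]
      and_intros <;> grind
    · simp only [List.mem_cons, List.not_mem_nil, or_false, IsStraight]
      grind
  · obtain ⟨-, -, bcov⟩ := h.region_cycle hF s₃ s₂ s₁
    have hQ : ∀ F, F = M.face a ∨ F = M.face o := by
      refine M.forall_face_of_adjacent ?_ (d₀ := a) (Or.inl rfl)
      rintro d (hd | hd)
      · rcases acov d hd with rfl | rfl | rfl | rfl <;> simp [e₀, e₁, e₂, e₃, fo₁, fo₂, fo₃]
      · rcases bcov d hd with rfl | rfl | rfl | rfl <;> simp [ia, ia₁, ia₂, ia₃, fa₁, fa₂, fa₃]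
    rcases hQ M.outerFace with hh | hh
    · exact ha hh.symm
    · exact hF hh.symm

end IsHexagonOfTwoSquares
end PlanarMap

namespace PlanarMap

variable {M : PlanarMap}

theorem exists_face_ne_outerFace (hM : M.numRegions ≠ 0) : ∃ d, M.face d ≠ M.outerFace := by
  have : Nonempty M.Region := by
    by_contra hne
    rw [not_nonempty_iff] at hne
    exact hM Nat.card_of_isEmpty
  obtain ⟨⟨F, hF⟩⟩ := this
  obtain ⟨d, rfl⟩ := Quotient.exists_rep F
  exact ⟨d, hF⟩

theorem IsStraight.of_inv {d : M.Dart} (h : M.IsStraight (M.inv d)) : M.IsStraight (M.next d) := by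
  rw [IsStraight, M.inv_inv] at h
  rw [IsStraight, h, M.inv_inv]

theorem IsStraight.next_inv_eq {d e : M.Dart} (he : M.next d = e) (h : M.IsStraight e) :
    M.next (M.inv e) = M.inv d := by
  subst he
  exact (isStraight_next_iff M).1 h

namespace IsHexagonOfTwoSquares

theorem exists_two_bends (h : M.IsHexagonOfTwoSquares) {a : M.Dart}
    (ha : M.face a ≠ M.outerFace) :
    ∃ u v, u ≠ v ∧ M.face u = M.face a ∧ M.face v = M.face a ∧
      ¬ M.IsStraight u ∧ ¬ M.IsStraight v := by
  have key : ∀ b, M.face b = M.face a → ∃ c, c ≠ b ∧ M.face c = M.face a ∧ ¬ M.IsStraight c := by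
    intro b hb
    have hb' := h.exists_bend_of_region (hb ▸ ha) rfl rfl rfl
    obtain ⟨-, hd, -⟩ := h.region_cycle (hb ▸ ha) rfl rfl rfl
    have f₁ := M.face_next b
    have f₂ := M.face_next (M.next b)
    have f₃ := M.face_next (M.next (M.next b))
    by_cases s₁ : M.IsStraight (M.next b)
    · by_cases s₂ : M.IsStraight (M.next (M.next b))
      · exact ⟨_, hd.2.2.1.symm, by rw [f₃, f₂, f₁, hb], fun s₃ => hb' ⟨s₁, s₂, s₃⟩⟩
      · exact ⟨_, hd.2.1.symm, by rw [f₂, f₁, hb], s₂⟩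
    · exact ⟨_, hd.1.symm, by rw [f₁, hb], s₁⟩
  obtain ⟨u, -, hu, su⟩ := key a rfl
  obtain ⟨v, hvu, hv, sv⟩ := key u hu
  exact ⟨u, v, hvu.symm, hu, hv, su, sv⟩

theorem exists_two_regions (h : M.IsHexagonOfTwoSquares) :
    ∃ a b, M.face a ≠ M.outerFace ∧ M.face b ≠ M.outerFace ∧ M.face a ≠ M.face b := by
  obtain ⟨⟨A, hA⟩, ⟨B, hB⟩, hAB, -⟩ := Nat.card_eq_two_iff.1 h.numRegions_eq
  obtain ⟨a, rfl⟩ := Quotient.exists_rep A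
  obtain ⟨b, rfl⟩ := Quotient.exists_rep B
  exact ⟨a, b, hA, hB, fun hab => hAB (Subtype.ext hab)⟩

/-- The two regions use up four of the at most six bends. -/
theorem outer_bends_le_two (h : M.IsHexagonOfTwoSquares) {u v w : M.Dart}
    (hu : M.face u = M.outerFace) (hv : M.face v = M.outerFace) (hw : M.face w = M.outerFace)
    (su : ¬ M.IsStraight u) (sv : ¬ M.IsStraight v) (sw : ¬ M.IsStraight w)
    (huv : u ≠ v) (huw : u ≠ w) (hvw : v ≠ w) : False := by
  obtain ⟨a, b, ha, hb, hab⟩ := h.exists_two_regions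
  obtain ⟨a₁, a₂, ha12, fa₁, fa₂, sa₁, sa₂⟩ := h.exists_two_bends ha
  obtain ⟨b₁, b₂, hb12, fb₁, fb₂, sb₁, sb₂⟩ := h.exists_two_bends hb
  refine h.false_of_seven_bends [u, v, w, a₁, a₂, b₁, b₂] ?_ (by simp) ?_
  · simp only [List.nodup_cons, List.mem_cons, List.not_mem_nil, or_false, not_or,
      List.nodup_nil, not_false_eq_true, and_true]
    and_intros <;> grind
  · simp only [List.mem_cons, List.not_mem_nil, or_false]
    rintro d (rfl | rfl | rfl | rfl | rfl | rfl | rfl) <;> assumption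

section OuterCycle

variable {o o₁ o₂ o₃ o₄ o₅ : M.Dart}

/-- The boundary bends twice at least: otherwise five consecutive edges of it would lie on one
region, or the boundary would be glued to itself. -/
theorem not_four_straight_outer (h : M.IsHexagonOfTwoSquares) (ho : M.face o = M.outerFace)
    (h₁ : M.next o = o₁) (h₂ : M.next o₁ = o₂) (h₃ : M.next o₂ = o₃) (h₄ : M.next o₃ = o₄)
    (h₅ : M.next o₄ = o₅) (s₂ : M.IsStraight o₂) (s₃ : M.IsStraight o₃) (s₄ : M.IsStraight o₄)
    (s₅ : M.IsStraight o₅) : False := by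
  obtain ⟨h6, hd, hcov⟩ := h.outer_cycle ho h₁ h₂ h₃ h₄ h₅
  have t₂ := s₂.next_inv_eq h₂
  have t₃ := s₃.next_inv_eq h₃
  have t₄ := s₄.next_inv_eq h₄
  have t₅ := s₅.next_inv_eq h₅
  have f₁ : M.face o₁ = M.outerFace := by rw [← h₁, face_next, ho]
  have f₂ : M.face o₂ = M.outerFace := by rw [← h₂, face_next, f₁]
  have f₃ : M.face o₃ = M.outerFace := by rw [← h₃, face_next, f₂]
  have f₄ : M.face o₄ = M.outerFace := by rw [← h₄, face_next, f₃]
  have f₅ : M.face o₅ = M.outerFace := by rw [← h₅, face_next, f₄]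
  have g₄ : M.face (M.inv o₄) = M.face (M.inv o₅) := by rw [← t₅, face_next]
  have g₃ : M.face (M.inv o₃) = M.face (M.inv o₅) := by rw [← t₄, face_next, g₄]
  have g₂ : M.face (M.inv o₂) = M.face (M.inv o₅) := by rw [← t₃, face_next, g₃]
  have g₁ : M.face (M.inv o₁) = M.face (M.inv o₅) := by rw [← t₂, face_next, g₂]
  by_cases hF : M.face (M.inv o₅) = M.outerFace
  · -- All edges of the boundary but one are then glued to edges of the boundary, hence all are.
    have hQ : ∀ F, F = M.outerFace := by
      have i₁ := M.inv_inv o₁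
      have g₀ : M.face (M.inv o) = M.outerFace := by
        have k₁ := hcov _ (g₁.trans hF)
        have k₂ := hcov _ (g₂.trans hF)
        have k₃ := hcov _ (g₃.trans hF)
        have k₄ := hcov _ (g₄.trans hF)
        have k₅ := hcov _ hF
        have n₁ := M.inv_ne o₁
        have n₂ := M.inv_ne o₂
        have n₃ := M.inv_ne o₃
        have n₄ := M.inv_ne o₄
        have n₅ := M.inv_ne o₅
        have m₅ := h.next_ne_inv o₅
        have m₄ := h.next_ne_inv o₄
        have m₃ := h.next_ne_inv o₃
        have m₂ := h.next_ne_inv o₂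
        have m₁ := h.next_ne_inv o₁
        have i₂ := M.inv_inv o₂
        have i₃ := M.inv_inv o₃
        have i₄ := M.inv_inv o₄
        have i₅ := M.inv_inv o₅
        clear hcov
        grind
      refine M.forall_face_of_adjacent ?_ (d₀ := o) ho
      intro d hd'
      rcases hcov d hd' with rfl | rfl | rfl | rfl | rfl | rfl
      · exact g₀
      · exact g₁.trans hF
      · exact g₂.trans hF
      · exact g₃.trans hF
      · exact g₄.trans hF
      · exact hF
    obtain ⟨a, -, ha, -⟩ := h.exists_two_regions
    exact ha (hQ _)
  · obtain ⟨h4, -⟩ := h.region_cycle hF t₅ t₄ t₃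
    rw [t₂] at h4
    exact hd.2.2.2.2.2.2.2.2.1 (M.inv.injective h4)

/-- The two bends of the boundary do not cut it into paths of lengths two and four, as one region
would then be surrounded by the path of length four. -/
theorem false_of_bends_zero_two (h : M.IsHexagonOfTwoSquares) (ho : M.face o = M.outerFace)
    (h₁ : M.next o = o₁) (h₂ : M.next o₁ = o₂) (h₃ : M.next o₂ = o₃) (h₄ : M.next o₃ = o₄)
    (h₅ : M.next o₄ = o₅) (s₀ : ¬ M.IsStraight o) (s₁ : M.IsStraight o₁)
    (s₂ : ¬ M.IsStraight o₂) (s₃ : M.IsStraight o₃) (s₄ : M.IsStraight o₄)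
    (s₅ : M.IsStraight o₅) : False := by
  obtain ⟨h6, hd, hcov⟩ := h.outer_cycle ho h₁ h₂ h₃ h₄ h₅
  have t₁ := s₁.next_inv_eq h₁
  have t₃ := s₃.next_inv_eq h₃
  have t₄ := s₄.next_inv_eq h₄
  have t₅ := s₅.next_inv_eq h₅
  have b₅ : ¬ M.IsStraight (M.inv o₅) := fun hs => s₀ (h6 ▸ hs.of_inv)
  have b₁ : ¬ M.IsStraight (M.inv o₁) := fun hs => s₂ (h₂ ▸ hs.of_inv)
  have f₁ : M.face o₁ = M.outerFace := by rw [← h₁, face_next, ho]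
  have f₂ : M.face o₂ = M.outerFace := by rw [← h₂, face_next, f₁]
  have f₃ : M.face o₃ = M.outerFace := by rw [← h₃, face_next, f₂]
  have f₄ : M.face o₄ = M.outerFace := by rw [← h₄, face_next, f₃]
  have f₅ : M.face o₅ = M.outerFace := by rw [← h₅, face_next, f₄]
  have g₀ : M.face (M.inv o) = M.face (M.inv o₁) := by rw [← t₁, face_next]
  have g₄ : M.face (M.inv o₄) = M.face (M.inv o₅) := by rw [← t₅, face_next]
  have g₃ : M.face (M.inv o₃) = M.face (M.inv o₅) := by rw [← t₄, face_next, g₄]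
  have g₂ : M.face (M.inv o₂) = M.face (M.inv o₅) := by rw [← t₃, face_next, g₃]
  have n₀ := M.inv_ne o
  have m₀ := h.next_ne_inv o
  have m₁ := h.next_ne_inv o₁
  have m₃ := h.next_ne_inv o₃
  have m₅ := h.next_ne_inv o₅
  have i₀ := M.inv_inv o
  have i₁ := M.inv_inv o₁
  have i₂ := M.inv_inv o₂
  have i₃ := M.inv_inv o₃
  have i₄ := M.inv_inv o₄
  have i₅ := M.inv_inv o₅
  have hB : M.face (M.inv o₅) ≠ M.outerFace := by
    intro hh
    have := hcov _ hh
    clear hcov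
    grind
  have hA : M.face (M.inv o₁) ≠ M.outerFace := by
    intro hh
    have := hcov _ hh
    clear hcov
    grind
  obtain ⟨-, -, bcov⟩ := h.region_cycle hB t₅ t₄ t₃
  have hAB : M.face (M.inv o₁) ≠ M.face (M.inv o₅) := by
    intro hh
    have := bcov _ hh
    have := M.inv.injective.eq_iff (a := o₁) (b := o₅)
    have := M.inv.injective.eq_iff (a := o₁) (b := o₄)
    have := M.inv.injective.eq_iff (a := o₁) (b := o₃)
    have := M.inv.injective.eq_iff (a := o₁) (b := o₂)
    clear hcov bcov
    grind
  -- The remaining two edges of the other region would be consecutive and glued to each other.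
  obtain ⟨τ, hτ⟩ : ∃ τ, M.next (M.inv o) = τ := ⟨_, rfl⟩
  obtain ⟨τ', hτ'⟩ : ∃ τ', M.next τ = τ' := ⟨_, rfl⟩
  obtain ⟨a4, and, acov⟩ := h.region_cycle hA t₁ hτ hτ'
  have fτ : M.face τ = M.face (M.inv o₁) := by rw [← hτ, face_next, g₀]
  have iτ := M.inv_inv τ
  have nτ := M.inv_ne τ
  have mτ := h.next_ne_inv τ
  rcases h.face_trichotomy hA hB hAB (M.face (M.inv τ)) with hh | hh | hh
  · have := hcov _ hh
    clear hcov bcov acov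
    grind
  · have := acov _ hh
    clear hcov bcov acov
    grind
  · have := bcov _ hh
    clear hcov bcov acov
    grind

/-- If the two bends of the boundary are opposite, each half of the boundary lies on one region, and
the remaining edges of the two regions are glued to each other. -/
theorem splitsAt_of_bends_zero_three (h : M.IsHexagonOfTwoSquares) (ho : M.face o = M.outerFace)
    (h₁ : M.next o = o₁) (h₂ : M.next o₁ = o₂) (h₃ : M.next o₂ = o₃) (h₄ : M.next o₃ = o₄)
    (h₅ : M.next o₄ = o₅) (s₀ : ¬ M.IsStraight o) (s₁ : M.IsStraight o₁)
    (s₂ : M.IsStraight o₂) (s₃ : ¬ M.IsStraight o₃) (s₄ : M.IsStraight o₄)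
    (s₅ : M.IsStraight o₅) : M.SplitsAt o := by
  obtain ⟨h6, hd, hcov⟩ := h.outer_cycle ho h₁ h₂ h₃ h₄ h₅
  have t₁ := s₁.next_inv_eq h₁
  have t₂ := s₂.next_inv_eq h₂
  have t₄ := s₄.next_inv_eq h₄
  have t₅ := s₅.next_inv_eq h₅
  have b₅ : ¬ M.IsStraight (M.inv o₅) := fun hs => s₀ (h6 ▸ hs.of_inv)
  have b₂ : ¬ M.IsStraight (M.inv o₂) := fun hs => s₃ (h₃ ▸ hs.of_inv)
  have f₁ : M.face o₁ = M.outerFace := by rw [← h₁, face_next, ho]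
  have f₂ : M.face o₂ = M.outerFace := by rw [← h₂, face_next, f₁]
  have f₃ : M.face o₃ = M.outerFace := by rw [← h₃, face_next, f₂]
  have f₄ : M.face o₄ = M.outerFace := by rw [← h₄, face_next, f₃]
  have f₅ : M.face o₅ = M.outerFace := by rw [← h₅, face_next, f₄]
  have g₁ : M.face (M.inv o₁) = M.face (M.inv o₂) := by rw [← t₂, face_next]
  have g₀ : M.face (M.inv o) = M.face (M.inv o₂) := by rw [← t₁, face_next, g₁]
  have g₄ : M.face (M.inv o₄) = M.face (M.inv o₅) := by rw [← t₅, face_next]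
  have g₃ : M.face (M.inv o₃) = M.face (M.inv o₅) := by rw [← t₄, face_next, g₄]
  have n₁ := M.inv_ne o₁
  have n₄ := M.inv_ne o₄
  have m₂ := h.next_ne_inv o₂
  have m₅ := h.next_ne_inv o₅
  have i₀ := M.inv_inv o
  have i₁ := M.inv_inv o₁
  have i₂ := M.inv_inv o₂
  have i₃ := M.inv_inv o₃
  have i₄ := M.inv_inv o₄
  have i₅ := M.inv_inv o₅
  have hB : M.face (M.inv o₅) ≠ M.outerFace := by
    intro hh
    have := hcov _ hh
    clear hcov
    grind
  have hA : M.face (M.inv o₂) ≠ M.outerFace := by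
    intro hh
    have := hcov _ hh
    clear hcov
    grind
  obtain ⟨τ, hτ⟩ : ∃ τ, M.next (M.inv o) = τ := ⟨_, rfl⟩
  obtain ⟨τ', hτ'⟩ : ∃ τ', M.next (M.inv o₃) = τ' := ⟨_, rfl⟩
  obtain ⟨a4, and, acov⟩ := h.region_cycle hA t₂ t₁ hτ
  obtain ⟨b4, bnd, bcov⟩ := h.region_cycle hB t₅ t₄ hτ'
  have hAB : M.face (M.inv o₂) ≠ M.face (M.inv o₅) := by
    intro hh
    have k₅ := acov _ hh.symm
    have k₄ := acov _ (g₄.trans hh.symm)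
    clear hcov bcov acov
    grind
  have fτ : M.face τ = M.face (M.inv o₂) := by rw [← hτ, face_next, g₀]
  have iτ := M.inv_inv τ
  have nτ := M.inv_ne τ
  have hττ' : M.inv τ = τ' := by
    rcases h.face_trichotomy hA hB hAB (M.face (M.inv τ)) with hh | hh | hh
    · have := hcov _ hh
      clear hcov bcov acov
      grind
    · have := acov _ hh
      clear hcov bcov acov
      grind
    · have := bcov _ hh
      clear hcov bcov acov
      grind
  clear hcov bcov acov
  subst h₁ h₂ h₃ h₄ h₅ hτ
  refine ⟨t₂, t₁, a4, t₅, t₄, ?_, ?_, ?_, ?_, ?_⟩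
  · rw [hτ', hττ']
  · rw [hττ', b4]
  · rwa [g₀]
  · rwa [g₃]
  · rwa [g₀, g₃]

end OuterCycle

/-- Exchanging the roles of the two squares. -/
theorem _root_.PlanarMap.SplitsAt.shift {o : M.Dart} (hs : M.SplitsAt o)
    (h6 : M.next (M.next (M.next (M.next (M.next (M.next o))))) = o) :
    M.SplitsAt (M.next (M.next (M.next o))) := by
  obtain ⟨l₁, l₂, l₃, r₁, r₂, r₃, r₄, hl, hr, hlr⟩ := hs
  refine ⟨r₁, r₂, ?_, ?_, ?_, ?_, ?_, hr, ?_, ?_⟩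
  · rw [r₃, r₄]
  · rw [h6, l₁]
  · rw [h6, l₂]
  · rw [h6, r₃, M.inv_inv]
  · rw [r₃, M.inv_inv, h6, l₃]
  · rwa [h6]
  · rw [h6]
    exact hlr.symm

/-- A hexagon filled by two squares is a domino: its inner edge joins opposite corners. -/
theorem exists_splitsAt (h : M.IsHexagonOfTwoSquares) {d : M.Dart}
    (hd : M.face d = M.outerFace) :
    M.SplitsAt d ∨ M.SplitsAt (M.next d) ∨ M.SplitsAt (M.next (M.next d)) := by
  have key : ∃ o, M.face o = M.outerFace ∧ M.SplitsAt o := by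
    have hbend : ∃ o, M.face o = M.outerFace ∧ ¬ M.IsStraight o := by
      by_contra! hall
      refine h.not_four_straight_outer hd rfl rfl rfl rfl rfl (hall _ ?_) (hall _ ?_) (hall _ ?_)
        (hall _ ?_) <;> simp [face_next, hd]
    obtain ⟨o, ho, s₀⟩ := hbend
    obtain ⟨o₁, h₁⟩ : ∃ x, M.next o = x := ⟨_, rfl⟩
    obtain ⟨o₂, h₂⟩ : ∃ x, M.next o₁ = x := ⟨_, rfl⟩
    obtain ⟨o₃, h₃⟩ : ∃ x, M.next o₂ = x := ⟨_, rfl⟩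
    obtain ⟨o₄, h₄⟩ : ∃ x, M.next o₃ = x := ⟨_, rfl⟩
    obtain ⟨o₅, h₅⟩ : ∃ x, M.next o₄ = x := ⟨_, rfl⟩
    obtain ⟨h₆, hne, -⟩ := h.outer_cycle ho h₁ h₂ h₃ h₄ h₅
    have f₁ : M.face o₁ = M.outerFace := by rw [← h₁, face_next, ho]
    have f₂ : M.face o₂ = M.outerFace := by rw [← h₂, face_next, f₁]
    have f₃ : M.face o₃ = M.outerFace := by rw [← h₃, face_next, f₂]
    have f₄ : M.face o₄ = M.outerFace := by rw [← h₄, face_next, f₃]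
    have f₅ : M.face o₅ = M.outerFace := by rw [← h₅, face_next, f₄]
    have hone : ∀ u v, M.face u = M.outerFace → M.face v = M.outerFace → ¬ M.IsStraight u →
        o ≠ u → o ≠ v → u ≠ v → M.IsStraight v := by
      intro u v hu hv su hou hov huv
      by_contra sv
      exact h.outer_bends_le_two ho hu hv s₀ su sv hou hov huv
    obtain ⟨n₁, n₂, n₃, n₄, n₅, n₁₂, n₁₃, n₁₄, n₁₅, n₂₃, n₂₄, n₂₅, n₃₄, n₃₅, n₄₅⟩ := hne
    by_cases s₁ : M.IsStraight o₁
    · by_cases s₂ : M.IsStraight o₂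
      · by_cases s₃ : M.IsStraight o₃
        · by_cases s₄ : M.IsStraight o₄
          · exact (h.not_four_straight_outer f₅ h₆ h₁ h₂ h₃ h₄ s₁ s₂ s₃ s₄).elim
          · have s₅ := hone _ _ f₄ f₅ s₄ n₄ n₅ n₄₅
            exact (h.false_of_bends_zero_two f₄ h₅ h₆ h₁ h₂ h₃ s₄ s₅ s₀ s₁ s₂ s₃).elim
        · exact ⟨o, ho, h.splitsAt_of_bends_zero_three ho h₁ h₂ h₃ h₄ h₅ s₀ s₁ s₂ s₃
            (hone _ _ f₃ f₄ s₃ n₃ n₄ n₃₄) (hone _ _ f₃ f₅ s₃ n₃ n₅ n₃₅)⟩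
      · exact (h.false_of_bends_zero_two ho h₁ h₂ h₃ h₄ h₅ s₀ s₁ s₂
          (hone _ _ f₂ f₃ s₂ n₂ n₃ n₂₃) (hone _ _ f₂ f₄ s₂ n₂ n₄ n₂₄)
          (hone _ _ f₂ f₅ s₂ n₂ n₅ n₂₅)).elim
    · exact (h.not_four_straight_outer ho h₁ h₂ h₃ h₄ h₅ (hone _ _ f₁ f₂ s₁ n₁ n₂ n₁₂)
        (hone _ _ f₁ f₃ s₁ n₁ n₃ n₁₃) (hone _ _ f₁ f₄ s₁ n₁ n₄ n₁₄)
        (hone _ _ f₁ f₅ s₁ n₁ n₅ n₁₅)).elim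
  obtain ⟨o, ho, hs⟩ := key
  obtain ⟨d6, -, dcov⟩ := h.outer_cycle hd rfl rfl rfl rfl rfl
  have h6 := (h.outer_cycle ho rfl rfl rfl rfl rfl).1
  have hs' := hs.shift h6
  rcases dcov o ho with rfl | rfl | rfl | rfl | rfl | rfl
  · exact Or.inl hs
  · exact Or.inr (Or.inl hs)
  · exact Or.inr (Or.inr hs)
  · rw [d6] at hs'
    exact Or.inl hs'
  · rw [d6] at hs'
    exact Or.inr (Or.inl hs')
  · rw [d6] at hs'
    exact Or.inr (Or.inr hs')

end IsHexagonOfTwoSquares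
end PlanarMap

/-! ### Words and relators -/

theorem Letter.inverse_inverse {X : Type*} (a : Letter X) : a.inverse.inverse = a := by
  simp [Letter.inverse]

theorem Letter.ne_inverse_iff {X : Type*} {a b : Letter X} :
    b ≠ a.inverse ↔ (a.1 = b.1 → a.2 = b.2) := by
  rcases a with ⟨a, _ | _⟩ <;> rcases b with ⟨b, _ | _⟩ <;>
    simp [Letter.inverse, Prod.ext_iff, eq_comm]

theorem FreeGroup.invRev_eq_map_inverse {X : Type*} (L : List (Letter X)) :
    FreeGroup.invRev L = (L.map Letter.inverse).reverse := rfl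

theorem List.IsRotated.freeGroup_invRev {X : Type*} {L L' : List (Letter X)} (h : L ~r L') :
    FreeGroup.invRev L ~r FreeGroup.invRev L' := (h.map _).reverse

theorem FreeGroup.IsCyclicallyReduced.isRotated {X : Type*} {L L' : List (Letter X)}
    (h : FreeGroup.IsCyclicallyReduced L) (hr : L ~r L') : FreeGroup.IsCyclicallyReduced L' := by
  obtain ⟨n, hn, rfl⟩ := List.isRotated_iff_mod.1 hr
  rw [List.rotate_eq_drop_append_take hn]
  rw [← List.take_append_drop n L] at h
  obtain ⟨h₁, h₂⟩ := h
  rw [FreeGroup.IsReduced, List.isChain_append] at h₁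
  obtain ⟨h₃, h₄, h₅⟩ := h₁
  rcases eq_or_ne (L.take n) [] with hu | hu
  · rw [hu] at h₂ ⊢
    rw [List.append_nil]
    exact ⟨h₄, by simpa using h₂⟩
  rcases eq_or_ne (L.drop n) [] with hv | hv
  · rw [hv] at h₂ ⊢
    rw [List.nil_append]
    exact ⟨h₃, by simpa using h₂⟩
  rw [List.getLast?_append_of_ne_nil _ hv, List.head?_append_of_ne_nil _ hu] at h₂
  refine ⟨?_, ?_⟩
  · rw [FreeGroup.IsReduced, List.isChain_append]
    exact ⟨h₄, h₃, h₂⟩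
  · rw [List.getLast?_append_of_ne_nil _ hu, List.head?_append_of_ne_nil _ hv]
    exact h₅

theorem FreeGroup.IsCyclicallyReduced.invRev {X : Type*} {L : List (Letter X)}
    (h : FreeGroup.IsCyclicallyReduced L) :
    FreeGroup.IsCyclicallyReduced (FreeGroup.invRev L) := by
  obtain ⟨h₁, h₂⟩ := h
  refine ⟨?_, ?_⟩
  · rw [FreeGroup.invRev_eq_map_inverse, FreeGroup.IsReduced, List.isChain_reverse,
      List.isChain_map]
    refine List.IsChain.imp ?_ h₁
    intro a b hab
    simpa [Letter.inverse, eq_comm] using hab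
  · rw [FreeGroup.invRev_eq_map_inverse, List.getLast?_reverse, List.head?_reverse,
      List.head?_map, List.getLast?_map]
    intro a ha b hb hab
    obtain ⟨a, ha', rfl⟩ := Option.map_eq_some_iff.1 ha
    obtain ⟨b, hb', rfl⟩ := Option.map_eq_some_iff.1 hb
    have := h₂ b hb' a ha' hab.symm
    simp [Letter.inverse, this]

theorem FreeGroup.IsCyclicallyReduced.ne_inverse {X : Type*} {a b : Letter X}
    {L : List (Letter X)} (h : FreeGroup.IsCyclicallyReduced (a :: b :: L)) : b ≠ a.inverse :=
  Letter.ne_inverse_iff.2 (FreeGroup.isReduced_cons_cons.1 h.1).1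

section Relators

variable {X : Type*} {R : Set (List (Letter X))}

theorem symmetricClosure_isRotated {w w' : List (Letter X)} (h : w ∈ symmetricClosure R)
    (hr : w ~r w') : w' ∈ symmetricClosure R := by
  obtain ⟨r, hrR, h | h⟩ := h
  · exact ⟨r, hrR, Or.inl (hr.symm.trans h)⟩
  · exact ⟨r, hrR, Or.inr (hr.symm.trans h)⟩

theorem symmetricClosure_invRev {w : List (Letter X)} (h : w ∈ symmetricClosure R) :
    FreeGroup.invRev w ∈ symmetricClosure R := by
  obtain ⟨r, hrR, h | h⟩ := h
  · exact ⟨r, hrR, Or.inr h.freeGroup_invRev⟩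
  · refine ⟨r, hrR, Or.inl ?_⟩
    simpa [FreeGroup.invRev_invRev] using h.freeGroup_invRev

theorem length_of_mem_symmetricClosure (hLength : ∀ r ∈ R, r.length = 4) {w : List (Letter X)}
    (h : w ∈ symmetricClosure R) : w.length = 4 := by
  obtain ⟨r, hrR, h | h⟩ := h
  · rw [h.perm.length_eq, hLength r hrR]
  · rw [h.perm.length_eq, FreeGroup.invRev_length, hLength r hrR]

theorem isCyclicallyReduced_of_mem_symmetricClosure
    (hReduced : ∀ r ∈ R, FreeGroup.IsCyclicallyReduced r) {w : List (Letter X)}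
    (h : w ∈ symmetricClosure R) : FreeGroup.IsCyclicallyReduced w := by
  obtain ⟨r, hrR, h | h⟩ := h
  · exact (hReduced r hrR).isRotated h.symm
  · exact (hReduced r hrR).invRev.isRotated h.symm

variable (R) in
/-- The word `pqrs` is a relator up to inversion and cyclic permutation. -/
def IsSquareRelator (p q r s : Letter X) : Prop := [p, q, r, s] ∈ symmetricClosure R

variable {p q r s : Letter X}

theorem IsSquareRelator.rotate (h : IsSquareRelator R p q r s) : IsSquareRelator R q r s p :=
  symmetricClosure_isRotated h ⟨1, rfl⟩

theorem IsSquareRelator.reverse (h : IsSquareRelator R p q r s) :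
    IsSquareRelator R s.inverse r.inverse q.inverse p.inverse :=
  symmetricClosure_invRev h

theorem IsSquareRelator.ne_inverse (h : IsSquareRelator R p q r s)
    (hReduced : ∀ r ∈ R, FreeGroup.IsCyclicallyReduced r) : q ≠ p.inverse :=
  (isCyclicallyReduced_of_mem_symmetricClosure hReduced h).ne_inverse

end Relators

/-! ### Diagrams with few regions -/

theorem PlanarMap.map_faceWalk_isRotated (M : PlanarMap) {α : Type*} (f : M.Dart → α)
    {d e : M.Dart} (h : M.face d = M.face e) :
    (M.faceWalk d).map f ~r (M.faceWalk e).map f := by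
  obtain ⟨k, -, rfl⟩ := M.exists_iterate_eq_of_face_eq h
  exact List.IsRotated.map ⟨k, (M.faceWalk_iterate d k).symm⟩ _

namespace VanKampenDiagram

variable {X : Type*} {R : Set (List (Letter X))} (M : VanKampenDiagram R)

/-- A diagram that is not minimal can be replaced by one with fewer regions and the same boundary
label from any prescribed starting point. -/
theorem exists_fewer_regions (hM : ¬ M.IsMinimal) {d₀ : M.Dart} (h₀ : M.StartsBoundaryCycle d₀) :
    ∃ (M' : VanKampenDiagram R) (d' : M'.Dart), M'.StartsBoundaryCycle d' ∧
      M'.boundaryLabel d' = M.boundaryLabel d₀ ∧ M'.numRegions < M.numRegions := by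
  unfold IsMinimal at hM
  push Not at hM
  obtain ⟨d, hd, M', d', hd', hl, hlt⟩ := hM
  obtain ⟨k, -, rfl⟩ := M.exists_iterate_eq_of_face_eq (hd.trans h₀.symm)
  refine ⟨M', M'.next^[k] d', (M'.face_next_iterate d' k).trans hd', ?_, hlt⟩
  rw [boundaryLabel, boundaryLabel, M'.faceWalk_iterate, M.faceWalk_iterate, List.map_rotate,
    List.map_rotate]
  exact congrArg (fun w => w.rotate k) hl

/-- If the boundary label and the relators are cyclically reduced, no vertex has valence one. -/
theorem next_ne_inv (hReduced : ∀ r ∈ R, FreeGroup.IsCyclicallyReduced r) {d₀ : M.Dart}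
    (h₀ : M.StartsBoundaryCycle d₀) (hc : FreeGroup.IsCyclicallyReduced (M.boundaryLabel d₀))
    (d : M.Dart) : M.next d ≠ M.inv d := by
  have hd : FreeGroup.IsCyclicallyReduced ((M.faceWalk d).map M.label) := by
    by_cases hF : M.face d = M.outerFace
    · exact hc.isRotated (M.map_faceWalk_isRotated M.label (h₀.trans hF.symm))
    · exact isCyclicallyReduced_of_mem_symmetricClosure hReduced (M.label_region d hF)
  intro h
  have hl : M.label (M.next d) = (M.label d).inverse := by rw [h, M.label_inv]
  rw [PlanarMap.faceWalk] at hd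
  obtain ⟨n, hn⟩ := Nat.exists_eq_succ_of_ne_zero (M.minimalPeriod_next_pos d).ne'
  rw [hn] at hd
  rcases n with _ | n
  · have : M.next d = d := Function.minimalPeriod_eq_one_iff_isFixedPt.1 hn
    rw [this] at h
    exact M.inv_ne d h.symm
  · exact hd.ne_inverse hl

end VanKampenDiagram

namespace PlanarMap

variable {M : PlanarMap}

theorem one_le_numRegions (hleaf : ∀ d, M.next d ≠ M.inv d) : 1 ≤ M.numRegions := by
  have := M.ncard_not_isStraight_le hleaf
  omega

/-- Along the boundary of a single region, reversing edges reverses boundary cycles. -/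
theorem next_inv_next_of_numRegions_le_one (hleaf : ∀ d, M.next d ≠ M.inv d)
    (h1 : M.numRegions ≤ 1) (d : M.Dart) : M.next (M.inv (M.next d)) = M.inv d := by
  rw [← isStraight_next_iff]
  by_contra hd
  have h := M.ncard_not_isStraight_le hleaf
  have : 0 < {d | ¬ M.IsStraight d}.ncard := (Set.ncard_pos (Set.toFinite _)).2 ⟨_, hd⟩
  omega

theorem minimalPeriod_inv_of_numRegions_le_one (hleaf : ∀ d, M.next d ≠ M.inv d)
    (h1 : M.numRegions ≤ 1) (d : M.Dart) :
    Function.minimalPeriod M.next (M.inv d) = Function.minimalPeriod M.next d := by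
  have key : ∀ (k : ℕ) (d : M.Dart), M.next^[k] (M.inv (M.next^[k] d)) = M.inv d := by
    intro k
    induction k with
    | zero => intro d; rfl
    | succ k ih =>
      intro d
      rw [Function.iterate_succ_apply, Function.iterate_succ_apply',
        next_inv_next_of_numRegions_le_one hleaf h1, ih]
  have hdvd : ∀ d, Function.minimalPeriod M.next (M.inv d) ∣ Function.minimalPeriod M.next d := by
    intro d
    apply Function.IsPeriodicPt.minimalPeriod_dvd
    have := key (Function.minimalPeriod M.next d) d
    rwa [Function.iterate_minimalPeriod] at this
  refine Nat.dvd_antisymm (hdvd d) ?_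
  have := hdvd (M.inv d)
  rwa [M.inv_inv] at this

theorem face_inv_ne_outerFace_of_numRegions_le_one (hleaf : ∀ d, M.next d ≠ M.inv d)
    (h1 : M.numRegions ≤ 1) {d : M.Dart} (hd : M.face d = M.outerFace) :
    M.face (M.inv d) ≠ M.outerFace := by
  intro hF
  have hall : ∀ k : ℕ, M.face (M.inv (M.next^[k] d)) = M.outerFace := by
    intro k
    induction k with
    | zero => exact hF
    | succ k ih =>
      rw [Function.iterate_succ_apply', ← face_next,
        next_inv_next_of_numRegions_le_one hleaf h1, ih]
  have hQ : ∀ F, F = M.outerFace := by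
    refine M.forall_face_of_adjacent ?_ (d₀ := d) hd
    intro e he
    obtain ⟨k, -, rfl⟩ := M.exists_iterate_eq_of_face_eq (hd.trans he.symm)
    exact hall k
  obtain ⟨e, he⟩ := exists_face_ne_outerFace (M := M)
    (Nat.one_le_iff_ne_zero.1 (one_le_numRegions hleaf))
  exact he (hQ _)

end PlanarMap

namespace VanKampenDiagram

variable {X : Type*} {R : Set (List (Letter X))} (M : VanKampenDiagram R)

theorem length_faceWalk_region (hLength : ∀ r ∈ R, r.length = 4) {d : M.Dart}
    (hd : M.face d ≠ M.outerFace) : (M.faceWalk d).length = 4 := by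
  have := length_of_mem_symmetricClosure hLength (M.label_region d hd)
  simpa using this

theorem length_boundaryLabel (d : M.Dart) :
    (M.boundaryLabel d).length = (M.faceWalk d).length := List.length_map _

theorem length_boundaryLabel_of_numRegions_le_one (hLength : ∀ r ∈ R, r.length = 4)
    (hReduced : ∀ r ∈ R, FreeGroup.IsCyclicallyReduced r) (h1 : M.numRegions ≤ 1) {d : M.Dart}
    (hd : M.StartsBoundaryCycle d) (hc : FreeGroup.IsCyclicallyReduced (M.boundaryLabel d)) :
    (M.boundaryLabel d).length = 4 := by
  have hleaf := M.next_ne_inv hReduced hd hc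
  rw [length_boundaryLabel, PlanarMap.length_faceWalk,
    ← PlanarMap.minimalPeriod_inv_of_numRegions_le_one hleaf h1, ← PlanarMap.length_faceWalk]
  exact M.length_faceWalk_region hLength
    (PlanarMap.face_inv_ne_outerFace_of_numRegions_le_one hleaf h1 hd)

theorem isSquareRelator_of_numRegions_le_one (hLength : ∀ r ∈ R, r.length = 4)
    (hReduced : ∀ r ∈ R, FreeGroup.IsCyclicallyReduced r) (h1 : M.numRegions ≤ 1) {d : M.Dart}
    (hd : M.StartsBoundaryCycle d) {p q r s : Letter X} (hl : M.boundaryLabel d = [p, q, r, s])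
    (hc : FreeGroup.IsCyclicallyReduced [p, q, r, s]) : IsSquareRelator R p q r s := by
  have hleaf := M.next_ne_inv hReduced hd (hl ▸ hc)
  have hnext := PlanarMap.next_inv_next_of_numRegions_le_one hleaf h1
  have h4 : (M.faceWalk d).length = 4 := by rw [← length_boundaryLabel, hl]; rfl
  rw [boundaryLabel, M.faceWalk_eq_of_length_four h4] at hl
  simp only [List.map_cons, List.map_nil, List.cons.injEq, and_true] at hl
  obtain ⟨rfl, rfl, rfl, rfl⟩ := hl
  set e := M.inv (M.next (M.next (M.next d))) with he
  have hF : M.face e ≠ M.outerFace :=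
    PlanarMap.face_inv_ne_outerFace_of_numRegions_le_one hleaf h1
      (by rw [M.face_next, M.face_next, M.face_next]; exact hd)
  have hreg := M.label_region e hF
  rw [M.faceWalk_eq_of_length_four (M.length_faceWalk_region hLength hF), he, hnext, hnext,
    hnext] at hreg
  have := IsSquareRelator.reverse (R := R) hreg
  simpa [M.label_inv, Letter.inverse_inverse] using this

theorem isHexagonOfTwoSquares (hLength : ∀ r ∈ R, r.length = 4)
    (hReduced : ∀ r ∈ R, FreeGroup.IsCyclicallyReduced r) (h2 : M.numRegions ≤ 2) {d : M.Dart}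
    (hd : M.StartsBoundaryCycle d) (hc : FreeGroup.IsCyclicallyReduced (M.boundaryLabel d))
    (h6 : (M.boundaryLabel d).length = 6) : M.IsHexagonOfTwoSquares := by
  refine ⟨?_, M.next_ne_inv hReduced hd hc, ?_, fun e he => M.length_faceWalk_region hLength he⟩
  · by_contra hne
    have := M.length_boundaryLabel_of_numRegions_le_one hLength hReduced (by omega) hd hc
    omega
  · intro e he
    rw [← h6, ← length_boundaryLabel]
    exact (M.map_faceWalk_isRotated M.label (he.trans hd.symm)).perm.length_eq

/-- The labels of the two regions of a domino. -/
theorem isSquareRelator_of_splitsAt (hLength : ∀ r ∈ R, r.length = 4)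
    {o : M.Dart} (hs : M.SplitsAt o) :
    IsSquareRelator R (M.label (M.next (M.inv o))).inverse (M.label o) (M.label (M.next o))
        (M.label (M.next (M.next o))) ∧
      IsSquareRelator R (M.label (M.next (M.inv o))) (M.label (M.next (M.next (M.next o))))
        (M.label (M.next (M.next (M.next (M.next o)))))
        (M.label (M.next (M.next (M.next (M.next (M.next o)))))) := by
  obtain ⟨l₁, l₂, l₃, r₁, r₂, r₃, r₄, hl, hr, -⟩ := hs
  have fl : M.face (M.inv (M.next (M.next o))) ≠ M.outerFace := by
    rwa [← M.face_next, l₁, ← M.face_next, l₂]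
  have fr : M.face (M.inv (M.next (M.next (M.next (M.next (M.next o)))))) ≠ M.outerFace := by
    rwa [← M.face_next, r₁, ← M.face_next, r₂]
  have hl := M.label_region _ fl
  have hr := M.label_region _ fr
  rw [M.faceWalk_eq_of_length_four (M.length_faceWalk_region hLength fl), l₁, l₂] at hl
  rw [M.faceWalk_eq_of_length_four (M.length_faceWalk_region hLength fr), r₁, r₂, r₃] at hr
  have hl := IsSquareRelator.reverse (R := R) hl
  have hr := IsSquareRelator.reverse (R := R) hr
  simp only [M.label_inv, Letter.inverse_inverse] at hl hr
  exact ⟨hl, hr⟩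

end VanKampenDiagram

/-! ### Diagrams given by tables -/

theorem Function.minimalPeriod_eq_of_iterate_ne {α : Type*} {f : α → α} {x : α} {k : ℕ}
    (hk : 0 < k) (h : f^[k] x = x) (hne : ∀ j < k, 0 < j → f^[j] x ≠ x) :
    Function.minimalPeriod f x = k := by
  have hp : Function.IsPeriodicPt f k x := h
  refine le_antisymm (hp.minimalPeriod_le hk) ?_
  by_contra! hlt
  exact hne _ hlt (hp.minimalPeriod_pos hk) Function.iterate_minimalPeriod

/-- The orbits of `π` are the fibres of `c`. -/
structure Equiv.Perm.IsOrbitColoring {n k : ℕ} (π : Equiv.Perm (Fin n)) (c : Fin n → Fin k)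
    (rep : Fin k → Fin n) : Prop where
  color_apply : ∀ d, c (π d) = c d
  color_rep : ∀ j, c (rep j) = j
  exists_iterate : ∀ d, ∃ i : Fin n, π^[i] (rep (c d)) = d

namespace Equiv.Perm.IsOrbitColoring

variable {n k : ℕ} {π : Equiv.Perm (Fin n)} {c : Fin n → Fin k} {rep : Fin k → Fin n}

theorem mk_eq_mk_iff (h : π.IsOrbitColoring c rep) {d e : Fin n} :
    (Quotient.mk (Equiv.Perm.SameCycle.setoid π) d = Quotient.mk _ e) ↔ c d = c e := by
  constructor
  · intro hq
    obtain ⟨i, rfl⟩ := (Quotient.exact hq : π.SameCycle d e).exists_nat_pow_eq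
    clear hq
    induction i with
    | zero => rfl
    | succ i ih => rw [pow_succ', Equiv.Perm.mul_apply, h.color_apply, ih]
  · intro hc
    have hs : ∀ d, π.SameCycle (rep (c d)) d := fun d => by
      obtain ⟨i, hi⟩ := h.exists_iterate d
      exact ⟨i, by rw [zpow_natCast, ← Equiv.Perm.iterate_eq_pow, hi]⟩
    exact Quotient.sound ((hs d).symm.trans (hc ▸ hs e))

theorem card_quotient (h : π.IsOrbitColoring c rep) :
    Nat.card (Quotient (Equiv.Perm.SameCycle.setoid π)) = k := by
  rw [← Nat.card_fin k]
  refine (Nat.card_congr (Equiv.ofBijective (fun j => Quotient.mk _ (rep j)) ⟨?_, ?_⟩)).symm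
  · intro i j hij
    have := h.mk_eq_mk_iff.1 hij
    rwa [h.color_rep, h.color_rep] at this
  · intro q
    obtain ⟨d, rfl⟩ := Quotient.exists_rep q
    exact ⟨c d, h.mk_eq_mk_iff.2 (h.color_rep _)⟩

end Equiv.Perm.IsOrbitColoring

/-- A connected spherical map on the darts `0, …, n - 1`, whose outer face is the one on the left
of the dart `faceRep 0` and whose regions are the square faces numbered `1, …, m`. -/
structure SquareMapTable (n m : ℕ) where
  inv : Equiv.Perm (Fin n)
  next : Equiv.Perm (Fin n)
  inv_inv : ∀ d, inv (inv d) = d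
  inv_ne : ∀ d, inv d ≠ d
  v : ℕ
  e : ℕ
  vertexColor : Fin n → Fin v
  vertexRep : Fin v → Fin n
  vertices : (next * inv).IsOrbitColoring vertexColor vertexRep
  edgeColor : Fin n → Fin e
  edgeRep : Fin e → Fin n
  edges : inv.IsOrbitColoring edgeColor edgeRep
  faceColor : Fin n → Fin (m + 1)
  faceRep : Fin (m + 1) → Fin n
  faces : next.IsOrbitColoring faceColor faceRep
  euler : v + (m + 1) = e + 2
  square : ∀ j, j ≠ 0 → next^[4] (faceRep j) = faceRep j ∧
    ∀ i < 4, 0 < i → next^[i] (faceRep j) ≠ faceRep j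
  exists_path : ∀ d, ∃ i j k : Fin n, next^[i] (inv^[j] (next^[k] (faceRep 0))) = d

namespace SquareMapTable

variable {n m : ℕ} (T : SquareMapTable n m)

/-- The planar map given by a table. -/
def toPlanarMap : PlanarMap where
  Dart := Fin n
  finite_dart := inferInstance
  inv := T.inv
  next := T.next
  inv_inv := T.inv_inv
  inv_ne := T.inv_ne
  connected := by
    have hnext : ∀ (k : ℕ) (d : Fin n),
        Relation.EqvGen (fun a b => b = T.inv a ∨ b = T.next a) d (T.next^[k] d) := by
      intro k d
      induction k with
      | zero => exact .refl _
      | succ k ih =>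
        rw [Function.iterate_succ_apply']
        exact ih.trans _ _ _ (.rel _ _ (Or.inr rfl))
    have hinv : ∀ (k : ℕ) (d : Fin n),
        Relation.EqvGen (fun a b => b = T.inv a ∨ b = T.next a) d (T.inv^[k] d) := by
      intro k d
      induction k with
      | zero => exact .refl _
      | succ k ih =>
        rw [Function.iterate_succ_apply']
        exact ih.trans _ _ _ (.rel _ _ (Or.inl rfl))
    have key : ∀ d, Relation.EqvGen (fun a b => b = T.inv a ∨ b = T.next a) (T.faceRep 0) d := by
      intro d
      obtain ⟨i, j, k, rfl⟩ := T.exists_path d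
      exact ((hnext _ _).trans _ _ _ (hinv _ _)).trans _ _ _ (hnext _ _)
    exact fun d d' => (key d).symm.trans _ _ _ (key d')
  euler := by
    rw [T.vertices.card_quotient, T.edges.card_quotient, T.faces.card_quotient, T.euler]
  outer := Quotient.mk _ (T.faceRep 0)

theorem face_eq_face_iff {d d' : Fin n} :
    T.toPlanarMap.face d = T.toPlanarMap.face d' ↔ T.faceColor d = T.faceColor d' :=
  T.faces.mk_eq_mk_iff

theorem face_eq_outerFace_iff {d : Fin n} :
    T.toPlanarMap.face d = T.toPlanarMap.outerFace ↔ T.faceColor d = 0 := by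
  refine T.faces.mk_eq_mk_iff.trans ?_
  rw [T.faces.color_rep]

theorem numRegions_eq : T.toPlanarMap.numRegions = m := by
  have h := T.toPlanarMap.card_face
  have h' : Nat.card T.toPlanarMap.Face = m + 1 := T.faces.card_quotient
  omega

theorem faceWalk_eq {d : Fin n} {k : ℕ} (hk : 0 < k) (h : T.next^[k] d = d)
    (hne : ∀ j < k, 0 < j → T.next^[j] d ≠ d) :
    T.toPlanarMap.faceWalk d = List.iterate T.next d k := by
  have : Function.minimalPeriod T.toPlanarMap.next d = k :=
    Function.minimalPeriod_eq_of_iterate_ne hk h hne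
  exact congrArg (List.iterate T.next d) this

/-- The diagram given by a table and a labelling under which the region walks spell relators. -/
def diagram {X : Type*} {R : Set (List (Letter X))} (label : Fin n → Letter X)
    (label_inv : ∀ d, label (T.inv d) = (label d).inverse)
    (isSquareRelator : ∀ j, j ≠ 0 → IsSquareRelator R (label (T.faceRep j))
      (label (T.next (T.faceRep j))) (label (T.next (T.next (T.faceRep j))))
      (label (T.next (T.next (T.next (T.faceRep j)))))) : VanKampenDiagram R where
  toPlanarMap := T.toPlanarMap
  label := label
  label_inv := label_inv
  label_region := by
    intro d hd
    have hc : T.faceColor d ≠ 0 := fun h => hd (T.face_eq_outerFace_iff.2 h)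
    have hF : T.toPlanarMap.face (T.faceRep (T.faceColor d)) = T.toPlanarMap.face d :=
      T.face_eq_face_iff.2 (T.faces.color_rep _)
    refine symmetricClosure_isRotated ?_ (T.toPlanarMap.map_faceWalk_isRotated label hF)
    obtain ⟨h4, hne⟩ := T.square _ hc
    exact (congrArg (fun w => List.map label w ∈ symmetricClosure R)
      (T.faceWalk_eq (by norm_num) h4 hne)).mpr (isSquareRelator _ hc)

end SquareMapTable

/-! ### The diagrams used -/

/-- Two squares with one edge in common: the boundary cycle is `0, …, 5`, the regions lie on the
left of the cycles `8, 7, 6, 12` and `11, 10, 9, 13`. -/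
def dominoTable : SquareMapTable 14 2 where
  inv := ⟨![6, 7, 8, 9, 10, 11, 0, 1, 2, 3, 4, 5, 13, 12],
    ![6, 7, 8, 9, 10, 11, 0, 1, 2, 3, 4, 5, 13, 12], by decide, by decide⟩
  next := ⟨![1, 2, 3, 4, 5, 0, 12, 6, 7, 13, 9, 10, 8, 11],
    ![5, 0, 1, 2, 3, 4, 7, 8, 12, 10, 11, 13, 6, 9], by decide, by decide⟩
  inv_inv := by decide
  inv_ne := by decide
  v := 6
  e := 7
  vertexColor := ![0, 1, 2, 3, 4, 5, 1, 2, 3, 4, 5, 0, 0, 3]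
  vertexRep := ![0, 1, 2, 3, 4, 5]
  vertices := ⟨by decide, by decide, by decide⟩
  edgeColor := ![0, 1, 2, 3, 4, 5, 0, 1, 2, 3, 4, 5, 6, 6]
  edgeRep := ![0, 1, 2, 3, 4, 5, 12]
  edges := ⟨by decide, by decide, by decide⟩
  faceColor := ![0, 0, 0, 0, 0, 0, 1, 1, 1, 2, 2, 2, 1, 2]
  faceRep := ![0, 8, 11]
  faces := ⟨by decide, by decide, by decide⟩
  euler := rfl
  square := by decide
  exists_path := by decide

/-- Two squares with two consecutive edges in common: the boundary cycle is `0, …, 3`, the regions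
lie on the left of the cycles `5, 4, 8, 9` and `7, 6, 10, 11`. -/
def twoSharedEdgesTable : SquareMapTable 12 2 where
  inv := ⟨![4, 5, 6, 7, 0, 1, 2, 3, 11, 10, 9, 8], ![4, 5, 6, 7, 0, 1, 2, 3, 11, 10, 9, 8],
    by decide, by decide⟩
  next := ⟨![1, 2, 3, 0, 8, 4, 10, 6, 9, 5, 11, 7], ![3, 0, 1, 2, 5, 9, 7, 11, 4, 8, 6, 10],
    by decide, by decide⟩
  inv_inv := by decide
  inv_ne := by decide
  v := 5
  e := 6
  vertexColor := ![0, 1, 2, 3, 1, 2, 3, 0, 0, 4, 2, 4]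
  vertexRep := ![0, 1, 2, 3, 9]
  vertices := ⟨by decide, by decide, by decide⟩
  edgeColor := ![0, 1, 2, 3, 0, 1, 2, 3, 4, 5, 5, 4]
  edgeRep := ![0, 1, 2, 3, 8, 9]
  edges := ⟨by decide, by decide, by decide⟩
  faceColor := ![0, 0, 0, 0, 1, 1, 2, 2, 1, 1, 2, 2]
  faceRep := ![0, 5, 7]
  faces := ⟨by decide, by decide, by decide⟩
  euler := rfl
  square := by decide
  exists_path := by decide

/-- Two squares with three consecutive edges in common: the boundary cycle is `0, 1`, the regions
lie on the left of the cycles `2, 4, 5, 6` and `3, 7, 8, 9`. -/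
def threeSharedEdgesTable : SquareMapTable 10 2 where
  inv := ⟨![2, 3, 0, 1, 9, 8, 7, 6, 5, 4], ![2, 3, 0, 1, 9, 8, 7, 6, 5, 4], by decide, by decide⟩
  next := ⟨![1, 0, 4, 7, 5, 6, 2, 8, 9, 3], ![1, 0, 6, 9, 2, 4, 5, 3, 7, 8], by decide, by decide⟩
  inv_inv := by decide
  inv_ne := by decide
  v := 4
  e := 5
  vertexColor := ![0, 1, 1, 0, 0, 2, 3, 1, 3, 2]
  vertexRep := ![0, 1, 5, 6]
  vertices := ⟨by decide, by decide, by decide⟩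
  edgeColor := ![0, 1, 0, 1, 2, 3, 4, 4, 3, 2]
  edgeRep := ![0, 1, 4, 5, 6]
  edges := ⟨by decide, by decide, by decide⟩
  faceColor := ![0, 0, 1, 2, 1, 1, 1, 2, 2, 2]
  faceRep := ![0, 2, 3]
  faces := ⟨by decide, by decide, by decide⟩
  euler := rfl
  square := by decide
  exists_path := by decide

/-- Three squares around an inner vertex: the boundary cycle is `0, …, 5`, the regions lie on the
left of the cycles `7, 6, 12, 13`, `9, 8, 14, 15` and `11, 10, 16, 17`, and the darts `13, 15, 17`
issue from the inner vertex. -/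
def threeSquaresTable : SquareMapTable 18 3 where
  inv := ⟨![6, 7, 8, 9, 10, 11, 0, 1, 2, 3, 4, 5, 17, 14, 13, 16, 15, 12],
    ![6, 7, 8, 9, 10, 11, 0, 1, 2, 3, 4, 5, 17, 14, 13, 16, 15, 12], by decide, by decide⟩
  next := ⟨![1, 2, 3, 4, 5, 0, 12, 6, 14, 8, 16, 10, 13, 7, 15, 9, 17, 11],
    ![5, 0, 1, 2, 3, 4, 7, 13, 9, 15, 11, 17, 6, 12, 8, 14, 10, 16], by decide, by decide⟩
  inv_inv := by decide
  inv_ne := by decide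
  v := 7
  e := 9
  vertexColor := ![0, 1, 2, 3, 4, 5, 1, 2, 3, 4, 5, 0, 0, 6, 2, 6, 4, 6]
  vertexRep := ![0, 1, 2, 3, 4, 5, 13]
  vertices := ⟨by decide, by decide, by decide⟩
  edgeColor := ![0, 1, 2, 3, 4, 5, 0, 1, 2, 3, 4, 5, 6, 7, 7, 8, 8, 6]
  edgeRep := ![0, 1, 2, 3, 4, 5, 12, 13, 15]
  edges := ⟨by decide, by decide, by decide⟩
  faceColor := ![0, 0, 0, 0, 0, 0, 1, 1, 2, 2, 3, 3, 1, 1, 2, 2, 3, 3]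
  faceRep := ![0, 7, 9, 11]
  faces := ⟨by decide, by decide, by decide⟩
  euler := rfl
  square := by decide
  exists_path := by decide

/-! ### Gluing squares -/

section Gluing

variable {X : Type*} {R : Set (List (Letter X))}

/-- Two squares with a common edge form a domino; its types from two starting points. -/
theorem exists_domino {l₀ l₁ l₂ l₃ l₄ l₅ t : Letter X}
    (h₁ : IsSquareRelator R t.inverse l₀ l₁ l₂) (h₂ : IsSquareRelator R t l₃ l₄ l₅) :
    ∃ (M : VanKampenDiagram R) (d : M.Dart), M.IsDomino ∧ M.StartsBoundaryCycle d ∧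
      M.boundaryLabel d = [l₀, l₁, l₂, l₃, l₄, l₅] ∧
      M.dominoType d = 3 ∧ M.dominoType (M.next d) = 2 := by
  let label : Fin 14 → Letter X := ![l₀, l₁, l₂, l₃, l₄, l₅, l₀.inverse, l₁.inverse, l₂.inverse,
    l₃.inverse, l₄.inverse, l₅.inverse, t, t.inverse]
  have hinv : ∀ d, label (dominoTable.inv d) = (label d).inverse := by
    intro d
    fin_cases d <;> simp [label, dominoTable, Letter.inverse_inverse]
  have hrel : ∀ j, j ≠ 0 → IsSquareRelator R (label (dominoTable.faceRep j))
      (label (dominoTable.next (dominoTable.faceRep j)))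
      (label (dominoTable.next (dominoTable.next (dominoTable.faceRep j))))
      (label (dominoTable.next (dominoTable.next (dominoTable.next (dominoTable.faceRep j))))) := by
    intro j hj
    fin_cases j
    · exact absurd rfl hj
    · have := h₁.reverse
      rw [Letter.inverse_inverse] at this
      exact this
    · exact h₂.reverse
  have hface := @SquareMapTable.face_eq_face_iff _ _ dominoTable
  have hout := @SquareMapTable.face_eq_outerFace_iff _ _ dominoTable
  have h6 : ∀ d, dominoTable.faceColor d = 0 → dominoTable.next^[6] d = d ∧
      ∀ j < 6, 0 < j → dominoTable.next^[j] d ≠ d := by decide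
  refine ⟨dominoTable.diagram label hinv hrel, (0 : Fin 14), ⟨dominoTable.numRegions_eq, ?_, ?_⟩,
    ?_, ?_, ?_, ?_⟩
  · intro d hd
    obtain ⟨h, hne⟩ := h6 d (hout.1 hd)
    exact (congrArg List.length (dominoTable.faceWalk_eq (by norm_num) h hne)).trans
      (List.length_iterate ..)
  · have hin : ∀ d, dominoTable.toPlanarMap.IsInnerEdge d ↔
        d = (12 : Fin 14) ∨ d = (13 : Fin 14) := by
      intro d
      have hdec : ∀ d : Fin 14, ¬ (dominoTable.faceColor d = 0 ∨
          dominoTable.faceColor (dominoTable.inv d) = 0) ↔ d = 12 ∨ d = 13 := by decide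
      refine Iff.trans ?_ (hdec d)
      exact not_congr (or_congr hout hout)
    refine Set.ncard_eq_one.2 ⟨dominoTable.toPlanarMap.edge (12 : Fin 14), ?_⟩
    ext e
    constructor
    · rintro ⟨d, rfl, hd⟩
      rcases (hin d).1 hd with rfl | rfl
      · rfl
      · exact dominoTable.edges.mk_eq_mk_iff.2 (by decide)
    · rintro rfl
      exact ⟨_, rfl, (hin _).2 (Or.inl rfl)⟩
  · exact hout.2 (by decide)
  · obtain ⟨h, hne⟩ := h6 0 (by decide)
    exact congrArg (List.map label) (dominoTable.faceWalk_eq (by norm_num) h hne)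
  · have e₁ : dominoTable.toPlanarMap.regionAt (0 : Fin 14) 0 =
        dominoTable.toPlanarMap.regionAt (0 : Fin 14) 1 := hface.2 (by decide)
    have e₂ : dominoTable.toPlanarMap.regionAt (0 : Fin 14) 1 =
        dominoTable.toPlanarMap.regionAt (0 : Fin 14) 2 := hface.2 (by decide)
    exact (if_pos e₁).trans (if_pos e₂)
  · have e₁ : dominoTable.toPlanarMap.regionAt (dominoTable.next 0) 0 =
        dominoTable.toPlanarMap.regionAt (dominoTable.next 0) 1 := hface.2 (by decide)
    have e₂ : dominoTable.toPlanarMap.regionAt (dominoTable.next 0) 1 ≠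
        dominoTable.toPlanarMap.regionAt (dominoTable.next 0) 2 :=
      fun h => absurd (hface.1 h) (by decide)
    exact (if_pos e₁).trans (if_neg e₂)

theorem FreeGroup.isCyclicallyReduced_four {p q r s : Letter X} (h₁ : q ≠ p.inverse)
    (h₂ : r ≠ q.inverse) (h₃ : s ≠ r.inverse) (h₄ : p ≠ s.inverse) :
    FreeGroup.IsCyclicallyReduced [p, q, r, s] := by
  rw [Letter.ne_inverse_iff] at *
  refine ⟨?_, ?_⟩
  · simpa [FreeGroup.IsReduced] using ⟨h₁, h₂, h₃⟩
  · simpa using h₄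

/-- Two squares with three consecutive edges in common agree in the fourth one. -/
theorem IsSquareRelator.eq_of_three_shared (hLength : ∀ r ∈ R, r.length = 4)
    (hReduced : ∀ r ∈ R, FreeGroup.IsCyclicallyReduced r)
    (hLetters : ∀ M : VanKampenDiagram R, M.IsMinimal → M.TwoRegionPathsAreLetters)
    {u r s₁ s₂ s₃ : Letter X} (h₁ : IsSquareRelator R u s₁ s₂ s₃)
    (h₂ : IsSquareRelator R s₃.inverse s₂.inverse s₁.inverse r) : r = u.inverse := by
  by_contra hne
  let label : Fin 10 → Letter X := ![u, r, u.inverse, r.inverse, s₃.inverse, s₂.inverse,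
    s₁.inverse, s₁, s₂, s₃]
  have hinv : ∀ d, label (threeSharedEdgesTable.inv d) = (label d).inverse := by
    intro d
    fin_cases d <;> simp [label, threeSharedEdgesTable, Letter.inverse_inverse]
  have hrel : ∀ j, j ≠ 0 → IsSquareRelator R (label (threeSharedEdgesTable.faceRep j))
      (label (threeSharedEdgesTable.next (threeSharedEdgesTable.faceRep j)))
      (label (threeSharedEdgesTable.next (threeSharedEdgesTable.next
        (threeSharedEdgesTable.faceRep j))))
      (label (threeSharedEdgesTable.next (threeSharedEdgesTable.next (threeSharedEdgesTable.next
        (threeSharedEdgesTable.faceRep j))))) := by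
    intro j hj
    fin_cases j
    · exact absurd rfl hj
    · exact h₁.reverse.rotate.rotate.rotate
    · have := h₂.reverse
      simp only [Letter.inverse_inverse] at this
      exact this
  have hface := @SquareMapTable.face_eq_face_iff _ _ threeSharedEdgesTable
  have hout := @SquareMapTable.face_eq_outerFace_iff _ _ threeSharedEdgesTable
  let M := threeSharedEdgesTable.diagram label hinv hrel
  have hM : ¬ M.IsMinimal := by
    intro hmin
    obtain ⟨a, ha⟩ := hLetters M hmin ([4, 5, 6] : List (Fin 10))
      ⟨threeSharedEdgesTable.toPlanarMap.face (4 : Fin 10), fun h => absurd (hout.1 h) (by decide)⟩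
      ⟨threeSharedEdgesTable.toPlanarMap.face (7 : Fin 10), fun h => absurd (hout.1 h) (by decide)⟩
      (List.cons_ne_nil _ _) (by
        refine ⟨?_, ⟨?_, ?_⟩, ⟨?_, ?_⟩⟩
        · intro h
          exact absurd (hface.1 (congrArg Subtype.val h)) (by decide)
        · intro d hd
          exact hface.2 ((by decide : ∀ d ∈ ([4, 5, 6] : List (Fin 10)),
            threeSharedEdgesTable.faceColor d = threeSharedEdgesTable.faceColor 4) d hd)
        · exact (by decide : ([4, 5, 6] : List (Fin 10)).IsChain
            (fun a b => threeSharedEdgesTable.next a = b))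
        · intro d hd
          exact hface.2 ((by decide : ∀ d ∈ ([7, 8, 9] : List (Fin 10)),
            threeSharedEdgesTable.faceColor d = threeSharedEdgesTable.faceColor 7) d hd)
        · exact (by decide : ([7, 8, 9] : List (Fin 10)).IsChain
            (fun a b => threeSharedEdgesTable.next a = b)))
    exact absurd (show 3 = 1 from congrArg List.length ha) (by norm_num)
  have h0 : M.StartsBoundaryCycle (0 : Fin 10) := hout.2 (by decide)
  obtain ⟨M', d', hd', hl, hlt⟩ := M.exists_fewer_regions hM h0
  have hl0 : M.boundaryLabel (0 : Fin 10) = [u, r] :=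
    congrArg (List.map label) (threeSharedEdgesTable.faceWalk_eq (d := 0) (k := 2) (by norm_num)
      (by decide) (by decide))
  have hreg : M.numRegions = 2 := threeSharedEdgesTable.numRegions_eq
  have hc : FreeGroup.IsCyclicallyReduced [u, r] := by
    have h := Letter.ne_inverse_iff.1 hne
    refine ⟨by simpa [FreeGroup.IsReduced] using h, ?_⟩
    simpa [eq_comm] using h
  rw [hl0] at hl
  have := M'.length_boundaryLabel_of_numRegions_le_one hLength hReduced (by omega) hd' (hl ▸ hc)
  rw [hl] at this
  simp at this

/-- Two squares with two consecutive edges in common do not form a minimal diagram, since the common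
path has length two. -/
theorem IsSquareRelator.glue_of_isCyclicallyReduced (hLength : ∀ r ∈ R, r.length = 4)
    (hReduced : ∀ r ∈ R, FreeGroup.IsCyclicallyReduced r)
    (hLetters : ∀ M : VanKampenDiagram R, M.IsMinimal → M.TwoRegionPathsAreLetters)
    {u₁ u₂ r₁ r₂ s₁ s₂ : Letter X} (h₁ : IsSquareRelator R u₁ u₂ s₁ s₂)
    (h₂ : IsSquareRelator R s₂.inverse s₁.inverse r₁ r₂)
    (hc : FreeGroup.IsCyclicallyReduced [u₁, u₂, r₁, r₂]) : IsSquareRelator R u₁ u₂ r₁ r₂ := by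
  let label : Fin 12 → Letter X := ![u₁, u₂, r₁, r₂, u₁.inverse, u₂.inverse, r₁.inverse,
    r₂.inverse, s₂.inverse, s₁.inverse, s₁, s₂]
  have hinv : ∀ d, label (twoSharedEdgesTable.inv d) = (label d).inverse := by
    intro d
    fin_cases d <;> simp [label, twoSharedEdgesTable, Letter.inverse_inverse]
  have hrel : ∀ j, j ≠ 0 → IsSquareRelator R (label (twoSharedEdgesTable.faceRep j))
      (label (twoSharedEdgesTable.next (twoSharedEdgesTable.faceRep j)))
      (label (twoSharedEdgesTable.next (twoSharedEdgesTable.next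
        (twoSharedEdgesTable.faceRep j))))
      (label (twoSharedEdgesTable.next (twoSharedEdgesTable.next (twoSharedEdgesTable.next
        (twoSharedEdgesTable.faceRep j))))) := by
    intro j hj
    fin_cases j
    · exact absurd rfl hj
    · exact h₁.reverse.rotate.rotate
    · have := h₂.reverse
      simp only [Letter.inverse_inverse] at this
      exact this
  have hface := @SquareMapTable.face_eq_face_iff _ _ twoSharedEdgesTable
  have hout := @SquareMapTable.face_eq_outerFace_iff _ _ twoSharedEdgesTable
  let M := twoSharedEdgesTable.diagram label hinv hrel
  have hM : ¬ M.IsMinimal := by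
    intro hmin
    obtain ⟨a, ha⟩ := hLetters M hmin ([8, 9] : List (Fin 12))
      ⟨twoSharedEdgesTable.toPlanarMap.face (8 : Fin 12), fun h => absurd (hout.1 h) (by decide)⟩
      ⟨twoSharedEdgesTable.toPlanarMap.face (10 : Fin 12), fun h => absurd (hout.1 h) (by decide)⟩
      (List.cons_ne_nil _ _) (by
        refine ⟨?_, ⟨?_, ?_⟩, ⟨?_, ?_⟩⟩
        · intro h
          exact absurd (hface.1 (congrArg Subtype.val h)) (by decide)
        · intro d hd
          exact hface.2 ((by decide : ∀ d ∈ ([8, 9] : List (Fin 12)),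
            twoSharedEdgesTable.faceColor d = twoSharedEdgesTable.faceColor 8) d hd)
        · exact (by decide : ([8, 9] : List (Fin 12)).IsChain
            (fun a b => twoSharedEdgesTable.next a = b))
        · intro d hd
          exact hface.2 ((by decide : ∀ d ∈ ([10, 11] : List (Fin 12)),
            twoSharedEdgesTable.faceColor d = twoSharedEdgesTable.faceColor 10) d hd)
        · exact (by decide : ([10, 11] : List (Fin 12)).IsChain
            (fun a b => twoSharedEdgesTable.next a = b)))
    exact absurd (show 2 = 1 from congrArg List.length ha) (by norm_num)
  have h0 : M.StartsBoundaryCycle (0 : Fin 12) := hout.2 (by decide)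
  obtain ⟨M', d', hd', hl, hlt⟩ := M.exists_fewer_regions hM h0
  have hl0 : M.boundaryLabel (0 : Fin 12) = [u₁, u₂, r₁, r₂] :=
    congrArg (List.map label) (twoSharedEdgesTable.faceWalk_eq (d := 0) (k := 4) (by norm_num)
      (by decide) (by decide))
  have hreg : M.numRegions = 2 := twoSharedEdgesTable.numRegions_eq
  exact M'.isSquareRelator_of_numRegions_le_one hLength hReduced (by omega) hd' (hl.trans hl0) hc

/-- Two squares with two consecutive edges in common can be replaced by a single square. -/
theorem IsSquareRelator.glue (hLength : ∀ r ∈ R, r.length = 4)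
    (hReduced : ∀ r ∈ R, FreeGroup.IsCyclicallyReduced r)
    (hLetters : ∀ M : VanKampenDiagram R, M.IsMinimal → M.TwoRegionPathsAreLetters)
    {u₁ u₂ r₁ r₂ s₁ s₂ : Letter X} (h₁ : IsSquareRelator R u₁ u₂ s₁ s₂)
    (h₂ : IsSquareRelator R s₂.inverse s₁.inverse r₁ r₂)
    (hne : r₁ ≠ u₂.inverse ∨ r₂ ≠ u₁.inverse) : IsSquareRelator R u₁ u₂ r₁ r₂ := by
  have h₃ : r₁ = u₂.inverse ↔ r₂ = u₁.inverse := by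
    constructor
    · rintro rfl
      exact h₁.eq_of_three_shared hLength hReduced hLetters h₂
    · rintro rfl
      exact h₁.rotate.eq_of_three_shared hLength hReduced hLetters h₂.rotate.rotate.rotate
  have hne₁ : r₁ ≠ u₂.inverse := hne.elim id fun h h' => h (h₃.1 h')
  have hne₂ : u₁ ≠ r₂.inverse := by
    rintro rfl
    exact hne₁ (h₃.2 (Letter.inverse_inverse _).symm)
  exact h₁.glue_of_isCyclicallyReduced hLength hReduced hLetters h₂
    (FreeGroup.isCyclicallyReduced_four (h₁.ne_inverse hReduced) hne₁
      (h₂.rotate.rotate.ne_inverse hReduced) hne₂)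

/-- Three squares around a vertex can be replaced by two squares with a common edge. -/
theorem exists_split_of_three_squares (hLength : ∀ r ∈ R, r.length = 4)
    (hReduced : ∀ r ∈ R, FreeGroup.IsCyclicallyReduced r)
    (hC4T4 : ∀ M : VanKampenDiagram R, M.IsMinimal → M.IsC4T4)
    {x y z l₀ l₁ l₂ l₃ l₄ l₅ : Letter X} (h₁ : IsSquareRelator R x y l₁.inverse l₀.inverse)
    (h₂ : IsSquareRelator R z.inverse y l₂ l₃) (h₃ : IsSquareRelator R x z l₄ l₅)
    (hc : FreeGroup.IsCyclicallyReduced [l₀, l₁, l₂, l₃, l₄, l₅]) :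
    ∃ t : Letter X,
      (IsSquareRelator R t.inverse l₀ l₁ l₂ ∧ IsSquareRelator R t l₃ l₄ l₅) ∨
      (IsSquareRelator R t.inverse l₁ l₂ l₃ ∧ IsSquareRelator R t l₄ l₅ l₀) ∨
      (IsSquareRelator R t.inverse l₂ l₃ l₄ ∧ IsSquareRelator R t l₅ l₀ l₁) := by
  let label : Fin 18 → Letter X := ![l₀, l₁, l₂, l₃, l₄, l₅, l₀.inverse, l₁.inverse, l₂.inverse,
    l₃.inverse, l₄.inverse, l₅.inverse, x, y, y.inverse, z, z.inverse, x.inverse]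
  have hinv : ∀ d, label (threeSquaresTable.inv d) = (label d).inverse := by
    intro d
    fin_cases d <;> simp [label, threeSquaresTable, Letter.inverse_inverse]
  have hrel : ∀ j, j ≠ 0 → IsSquareRelator R (label (threeSquaresTable.faceRep j))
      (label (threeSquaresTable.next (threeSquaresTable.faceRep j)))
      (label (threeSquaresTable.next (threeSquaresTable.next (threeSquaresTable.faceRep j))))
      (label (threeSquaresTable.next (threeSquaresTable.next (threeSquaresTable.next
        (threeSquaresTable.faceRep j))))) := by
    intro j hj
    fin_cases j
    · exact absurd rfl hj
    · exact h₁.rotate.rotate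
    · have := h₂.reverse
      rw [Letter.inverse_inverse] at this
      exact this
    · exact h₃.reverse
  have hout := @SquareMapTable.face_eq_outerFace_iff _ _ threeSquaresTable
  have horigin : ∀ d d' : Fin 18, threeSquaresTable.toPlanarMap.origin d =
      threeSquaresTable.toPlanarMap.origin d' ↔
      threeSquaresTable.vertexColor d = threeSquaresTable.vertexColor d' :=
    fun d d' => threeSquaresTable.vertices.mk_eq_mk_iff
  let M := threeSquaresTable.diagram label hinv hrel
  have hM : ¬ M.IsMinimal := by
    intro hmin
    refine (hC4T4 M hmin).2 (threeSquaresTable.toPlanarMap.origin (13 : Fin 18)) ?_ ?_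
    · rintro ⟨d, hd, hF⟩
      have h₁ : threeSquaresTable.vertexColor d = threeSquaresTable.vertexColor 13 :=
        (horigin d 13).1 hd
      have h₂ : threeSquaresTable.faceColor d = 0 := hout.1 hF
      exact (by decide : ∀ d : Fin 18, threeSquaresTable.vertexColor d =
        threeSquaresTable.vertexColor 13 → threeSquaresTable.faceColor d ≠ 0) d h₁ h₂
    · have : {d : Fin 18 | threeSquaresTable.toPlanarMap.origin d =
          threeSquaresTable.toPlanarMap.origin (13 : Fin 18)} =
          (({13, 15, 17} : Finset (Fin 18)) : Set (Fin 18)) := by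
        ext d
        exact (horigin d 13).trans ((by decide : ∀ d : Fin 18, threeSquaresTable.vertexColor d =
          threeSquaresTable.vertexColor 13 ↔ d ∈ ({13, 15, 17} : Finset (Fin 18))) d)
      exact (congrArg Set.ncard this).trans (Set.ncard_coe_finset _)
  have h0 : M.StartsBoundaryCycle (0 : Fin 18) := hout.2 (by decide)
  obtain ⟨M', d, hd, hl, hlt⟩ := M.exists_fewer_regions hM h0
  have hl0 : M.boundaryLabel (0 : Fin 18) = [l₀, l₁, l₂, l₃, l₄, l₅] :=
    congrArg (List.map label) (threeSquaresTable.faceWalk_eq (d := 0) (k := 6) (by norm_num)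
      (by decide) (by decide))
  have hreg : M.numRegions = 3 := threeSquaresTable.numRegions_eq
  rw [hl0] at hl
  have hhex := M'.isHexagonOfTwoSquares hLength hReduced (by omega) hd (hl ▸ hc) (by rw [hl]; rfl)
  have h6 : (M'.faceWalk d).length = 6 := hhex.length_outer d hd
  have hper := (hhex.outer_cycle hd rfl rfl rfl rfl rfl).1
  rw [VanKampenDiagram.boundaryLabel, M'.faceWalk_eq_of_length_six h6] at hl
  simp only [List.map_cons, List.map_nil, List.cons.injEq, and_true] at hl
  obtain ⟨rfl, rfl, rfl, rfl, rfl, rfl⟩ := hl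
  rcases hhex.exists_splitsAt hd with hs | hs | hs
  · exact ⟨_, Or.inl (M'.isSquareRelator_of_splitsAt hLength hs)⟩
  · have := M'.isSquareRelator_of_splitsAt hLength hs
    rw [hper] at this
    exact ⟨_, Or.inr (Or.inl this)⟩
  · have := M'.isSquareRelator_of_splitsAt hLength hs
    rw [hper] at this
    exact ⟨_, Or.inr (Or.inr this)⟩

end Gluing

/-! ### Stable triplets and closing letters -/

section Stability

variable {X : Type*} {R : Set (List (Letter X))}

/-- What stability of a triplet says about relators: there is a domino whose squares spell `xzba`
and `z⁻¹ycd`, and the other two ways of cutting the hexagon `xycdba` into squares are impossible. -/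
theorem IsStableTriplet.exists_squares (hLength : ∀ r ∈ R, r.length = 4)
    (hReduced : ∀ r ∈ R, FreeGroup.IsCyclicallyReduced r)
    {x y z : Letter X} (h : IsStableTriplet R x y z) :
    ∃ a b c d : Letter X, IsSquareRelator R x z b a ∧ IsSquareRelator R z.inverse y c d ∧
      FreeGroup.IsCyclicallyReduced [x, y, c, d, b, a] ∧
      (∀ t, IsSquareRelator R x y c t → ¬ IsSquareRelator R t.inverse d b a) ∧
      (∀ t, IsSquareRelator R t a x y → ¬ IsSquareRelator R t.inverse c d b) := by
  obtain ⟨N, e₁, e₂, e₃, ⟨hdom, hstab⟩, he₁, hc, rfl, hval, horig, hinner, rfl, rfl, rfl⟩ := h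
  have hlen : (N.faceWalk e₁).length = 6 := hdom.2.1 e₁ he₁
  have hhex := N.isHexagonOfTwoSquares hLength hReduced hdom.1.le he₁ hc
    (by rw [N.length_boundaryLabel, hlen])
  obtain ⟨o, ho⟩ : ∃ o, N.next e₁ = o := ⟨_, rfl⟩
  rw [ho] at hval horig ⊢
  have hoF : N.face o = N.outerFace := by rw [← ho, N.face_next]; exact he₁
  have h6 := (hhex.outer_cycle he₁ rfl rfl rfl rfl rfl).1
  rw [ho] at h6
  have ho6 := (hhex.outer_cycle hoF rfl rfl rfl rfl rfl).1
  rw [h6] at ho6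
  -- The vertex at the beginning of `o` has valence three, so the domino splits there.
  have hbend : ¬ N.IsStraight o := by
    intro hs
    have hsub : {d | N.origin d = N.origin o} ⊆ {o, N.next (N.inv o)} := by
      intro d hd
      obtain ⟨k, rfl⟩ := N.exists_iterate_eq_of_origin_eq (Eq.symm hd)
      clear hd
      induction k with
      | zero => exact Or.inl rfl
      | succ k ih =>
        rw [Function.iterate_succ_apply', Equiv.Perm.mul_apply]
        rcases ih with ih | ih
        · rw [ih]
          exact Or.inr rfl
        · rw [Set.mem_singleton_iff.1 ih]
          exact Or.inl hs
    have h₁ := Set.ncard_le_ncard hsub (Set.toFinite _)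
    have h₂ : ({o, N.next (N.inv o)} : Set N.Dart).ncard ≤ 1 + 1 :=
      (Set.ncard_insert_le _ _).trans_eq (by rw [Set.ncard_singleton])
    have h₃ : {d | N.origin d = N.origin o}.ncard = 3 := hval
    omega
  have hstr : ∀ p, N.SplitsAt p → N.IsStraight (N.next p) ∧ N.IsStraight (N.next (N.next p)) := by
    intro p hp
    rw [PlanarMap.isStraight_next_iff, PlanarMap.isStraight_next_iff]
    exact ⟨hp.left₂, hp.left₁⟩
  have hs : N.SplitsAt o := by
    rcases hhex.exists_splitsAt hoF with hs | hs | hs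
    · exact hs
    · have := (hstr _ (hs.shift (by rw [h6, ho]))).2
      rw [h6, ho] at this
      exact (hbend this).elim
    · have := (hstr _ (hs.shift (by rw [h6, ho]))).1
      rw [h6, ho] at this
      exact (hbend this).elim
  -- The inner edge at this vertex is the only one that is not on the boundary.
  have he₃ : e₃ = N.next (N.inv o) := by
    have hmem : e₃ = o ∨ e₃ = N.next (N.inv o) ∨ e₃ = N.inv e₁ := by
      obtain ⟨k, rfl⟩ := N.exists_iterate_eq_of_origin_eq horig.symm
      clear horig hinner
      induction k with
      | zero => exact Or.inl rfl
      | succ k ih =>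
        rw [Function.iterate_succ_apply', Equiv.Perm.mul_apply]
        rcases ih with ih | ih | ih
        · rw [ih]
          exact Or.inr (Or.inl rfl)
        · rw [ih, hs.right₄, h6]
          exact Or.inr (Or.inr rfl)
        · rw [ih, N.inv_inv, ho]
          exact Or.inl rfl
    rcases hmem with rfl | hmem | rfl
    · exact (hinner (Or.inl hoF)).elim
    · exact hmem
    · exact (hinner (Or.inr (by rw [N.inv_inv]; exact he₁))).elim
  have hsq := N.isSquareRelator_of_splitsAt hLength hs
  rw [h6, ← he₃] at hsq
  have hlab : N.boundaryLabel e₁ = [N.label e₁, N.label o, N.label (N.next o),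
      N.label (N.next (N.next o)), N.label (N.next (N.next (N.next o))),
      N.label (N.next (N.next (N.next (N.next o))))] := by
    rw [VanKampenDiagram.boundaryLabel, N.faceWalk_eq_of_length_six hlen, ho]
    rfl
  have htype : N.dominoType e₁ = 1 := by
    refine if_neg fun heq => hs.left_ne_right ?_
    have h₀ : N.regionAt e₁ 0 = N.face (N.inv (N.next (N.next (N.next o)))) := by
      change N.face (N.inv e₁) = _
      rw [← h6, ← N.face_next, hs.right₁, ← N.face_next, hs.right₂]
    have h₁ : N.regionAt e₁ 1 = N.face (N.inv o) := by
      change N.face (N.inv (N.next e₁)) = _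
      rw [ho]
    rw [← h₀, ← h₁, heq]
  refine ⟨_, _, _, _, hsq.2.rotate.rotate.rotate, hsq.1, hlab ▸ hc, ?_, ?_⟩
  · intro t h₁ h₂
    obtain ⟨M, d, hM, hd, hl, ht, -⟩ := exists_domino (t := t.inverse)
      (by rw [Letter.inverse_inverse]; exact h₁.rotate.rotate.rotate) h₂
    have := hstab e₁ he₁ M d hM hd (hl.trans hlab.symm)
    omega
  · intro t h₁ h₂
    obtain ⟨M, d, hM, hd, hl, -, ht⟩ := exists_domino (t := t.inverse)
      (by rw [Letter.inverse_inverse]; exact h₁) h₂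
    have := hstab e₁ he₁ M (M.next d) hM ((M.face_next d).trans hd) (by
      rw [VanKampenDiagram.boundaryLabel, M.faceWalk_next, List.map_rotate]
      exact (congrArg (fun w => w.rotate 1) hl).trans hlab.symm)
    omega

variable (R) in
/-- The letters `a` which end some relator `xyba` beginning with `xy`. -/
def closingLetters (x y : Letter X) : Set (Letter X) := {a | ∃ b, IsSquareRelator R x y b a}

/-- Along an edge of the stability graph the set of closing letters increases strictly. -/
theorem IsStableTriplet.closingLetters_ssubset (hLength : ∀ r ∈ R, r.length = 4)
    (hReduced : ∀ r ∈ R, FreeGroup.IsCyclicallyReduced r)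
    (hC4T4 : ∀ M : VanKampenDiagram R, M.IsMinimal → M.IsC4T4)
    (hLetters : ∀ M : VanKampenDiagram R, M.IsMinimal → M.TwoRegionPathsAreLetters)
    {x y z : Letter X} (h : IsStableTriplet R x y z) :
    closingLetters R x y ⊂ closingLetters R x z := by
  obtain ⟨a₁, b₁, c, d, hxz, hzy, hc, hst₁, hst₂⟩ := h.exists_squares hLength hReduced
  have glue : ∀ {u₁ u₂ r₁ r₂ s₁ s₂ : Letter X}, IsSquareRelator R u₁ u₂ s₁ s₂ →
      IsSquareRelator R s₂.inverse s₁.inverse r₁ r₂ → (r₁ ≠ u₂.inverse ∨ r₂ ≠ u₁.inverse) →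
      IsSquareRelator R u₁ u₂ r₁ r₂ :=
    fun h₁ h₂ hne => h₁.glue hLength hReduced hLetters h₂ hne
  have ii := @Letter.inverse_inverse X
  have hyc : c ≠ y.inverse := hzy.rotate.ne_inverse hReduced
  have hcd : d ≠ c.inverse := hzy.rotate.rotate.ne_inverse hReduced
  have hax : x ≠ a₁.inverse := hxz.rotate.rotate.rotate.ne_inverse hReduced
  have hba : a₁ ≠ b₁.inverse := hxz.rotate.rotate.ne_inverse hReduced
  have hzx : z ≠ x.inverse := hxz.ne_inverse hReduced
  have hzy' : y ≠ z := fun hyz => hzy.ne_inverse hReduced (by rw [ii, hyz])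
  have hdb : b₁ ≠ d.inverse := by
    have hr : FreeGroup.IsCyclicallyReduced [d, b₁, a₁, x, y, c] := hc.isRotated ⟨3, rfl⟩
    exact hr.ne_inverse
  refine ⟨?_, fun hsub => ?_⟩
  · rintro a ⟨b, hxy⟩
    by_cases haa : a = a₁
    · exact ⟨b₁, haa ▸ hxz⟩
    have hxa : x ≠ a.inverse := hxy.rotate.rotate.rotate.ne_inverse hReduced
    have hax' : a ≠ x.inverse := fun h => hxa (by rw [h, ii])
    -- In what follows, the squares `xyba`, `z⁻¹ycd` and `xzb₁a₁` surround a vertex.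
    by_cases hbc : b = c
    · -- Here `xyca` and `z⁻¹ycd` share the path `yc`. Gluing twice gives the square `a⁻¹db₁a₁`,
      -- which together with `xyca` cuts the hexagon `xycdb₁a₁` in a forbidden way.
      exfalso
      subst hbc
      have hA : IsSquareRelator R a x z d.inverse := by
        refine glue hxy.rotate.rotate.rotate (s₁ := y) (s₂ := b) ?_ (Or.inl ?_)
        · have := hzy.reverse.rotate
          rw [ii] at this
          exact this
        · exact hzx
      have hB : IsSquareRelator R d.inverse a a₁.inverse b₁.inverse := by
        refine glue hA.rotate.rotate.rotate (s₁ := x) (s₂ := z) ?_ (Or.inl ?_)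
        · exact hxz.reverse.rotate.rotate
        · intro h
          exact haa (by rw [← ii a, ← h, ii])
      refine hst₁ a hxy ?_
      have := hB.reverse.rotate.rotate
      simp only [ii] at this
      exact this
    · have hcH : FreeGroup.IsCyclicallyReduced [a.inverse, b.inverse, c, d, b₁, a₁] := by
        have hab : b.inverse ≠ a.inverse.inverse := hxy.reverse.ne_inverse hReduced
        have hbc' : c ≠ b.inverse.inverse := by
          rw [ii]
          exact fun h => hbc h.symm
        have haa' : a.inverse ≠ a₁.inverse := by
          intro h
          exact haa (by rw [← ii a, h, ii])
        rw [Letter.ne_inverse_iff] at hab hbc' hcd hdb hba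
        have haa'' := Letter.ne_inverse_iff.1 haa'
        refine ⟨?_, by simpa using haa''⟩
        simpa [FreeGroup.IsReduced] using ⟨hab, hbc', hcd, hdb, hba⟩
      obtain ⟨t, ⟨h₁, h₂⟩ | ⟨h₁, h₂⟩ | ⟨h₁, h₂⟩⟩ := exists_split_of_three_squares hLength hReduced
        hC4T4 (l₀ := a.inverse) (l₁ := b.inverse) (by rw [ii, ii]; exact hxy) hzy hxz hcH
      -- By stability, the inner edge of the replacing pair of squares can only join the other two
      -- opposite corners; it then provides the second square on `xz` that ends with `a`.
      · refine (hst₁ t.inverse ?_ (by rw [ii]; exact h₂)).elim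
        exact glue hxy h₁.rotate (Or.inl hyc)
      · refine ⟨t.inverse, glue hxz (r₂ := a) ?_ (Or.inr hax')⟩
        have := h₂.reverse.rotate
        rw [ii] at this
        exact this
      · refine (hst₂ t ?_ h₁).elim
        refine (glue hxy (r₁ := t) (r₂ := a₁) h₂.rotate.rotate (Or.inr ?_)).rotate.rotate
        intro h
        exact hax (by rw [h, ii])
  · -- If `a₁` closed `xy`, there would be a square `xyba₁`, and the hexagon `xycdb₁a₁` could be cut
    -- along the edge labelled `b` from the end of `y` to the start of `a₁`.
    obtain ⟨b, hxy⟩ := hsub ⟨b₁, hxz⟩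
    have hyz : IsSquareRelator R y b b₁.inverse z.inverse := by
      refine glue hxy.rotate (s₁ := a₁) (s₂ := x) hxz.reverse.rotate.rotate.rotate (Or.inr ?_)
      intro h
      exact hzy' (by rw [← ii y, ← h, ii])
    have hcb : IsSquareRelator R c d b₁ b.inverse := by
      refine glue hzy.rotate.rotate (s₁ := z.inverse) (s₂ := y) ?_ (Or.inl hdb)
      have := hyz.reverse.rotate.rotate.rotate
      rw [ii] at this ⊢
      rw [ii] at this
      exact this
    exact hst₂ b hxy.rotate.rotate hcb.rotate.rotate.rotate

end Stability

/-! ### Orders from acyclic relations -/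

/-- An irreflexive transitive closure extends to a linear order, read backwards. -/
theorem exists_linearOrder_of_not_transGen {α : Type*} {r : α → α → Prop}
    (h : ∀ a, ¬ Relation.TransGen r a a) : ∃ o : LinearOrder α, ∀ a b, r a b → o.lt b a := by
  let p : PartialOrder α :=
    { le := fun a b => Relation.ReflTransGen r b a
      le_refl := fun a => .refl
      le_trans := fun a b c hab hbc => hbc.trans hab
      le_antisymm := fun a b hab hba => by
        rcases Relation.reflTransGen_iff_eq_or_transGen.1 hab with rfl | hab'
        · rfl
        · exact (h _ (Relation.TransGen.trans_left hab' hba)).elim }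
  obtain ⟨o, ho⟩ : ∃ o : LinearOrder α, ∀ a b, p.le b a → o.le b a :=
    ⟨@id (LinearOrder (LinearExtension α)) inferInstance,
      fun _ _ hle => (toLinearExtension (α := α)).monotone hle⟩
  refine ⟨o, fun a b hab => ?_⟩
  have hle : o.le b a := ho a b (Relation.ReflTransGen.single hab)
  refine (@lt_iff_le_and_ne α o.toPartialOrder b a).2 ⟨hle, ?_⟩
  rintro rfl
  exact h _ (.single hab)

theorem mainTheorem4 {X : Type*} [Fintype X] (R : Set (List (Letter X)))
    (hLength : ∀ r ∈ R, r.length = 4)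
    (hReduced : ∀ r ∈ R, FreeGroup.IsCyclicallyReduced r)
    (hC4T4 : ∀ M : VanKampenDiagram R, M.IsMinimal → M.IsC4T4)
    (hLetters : ∀ M : VanKampenDiagram R, M.IsMinimal → M.TwoRegionPathsAreLetters)
    (x : Letter X) :
    (stabilityGraph R x).IsCycleFree ∧
    (∃ o : LinearOrder (Letter X), ∀ y z, IsStableTriplet R x y z → o.lt z y) ∧
    (∃ G : Letter X → ℕ, IsGradingFunction R x G) := by
  have hcycle : ∀ y, ¬ Relation.TransGen (IsStableTriplet R x) y y := by
    intro y hy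
    have hlt : ∀ z, Relation.TransGen (IsStableTriplet R x) y z →
        closingLetters R x y ⊂ closingLetters R x z := by
      intro z hz
      induction hz with
      | single h => exact h.closingLetters_ssubset hLength hReduced hC4T4 hLetters
      | tail _ h ih =>
        exact ih.trans (h.closingLetters_ssubset hLength hReduced hC4T4 hLetters)
    exact (hlt y hy).ne rfl
  obtain ⟨o, ho⟩ := exists_linearOrder_of_not_transGen hcycle
  refine ⟨hcycle, ⟨o, ho⟩, fun y => (Finset.univ.filter fun w => o.le w y).card, ?_, ?_⟩
  · intro y
    constructor
    · exact Finset.card_pos.2 ⟨y, by simp⟩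
    · refine (Finset.card_le_univ _).trans_eq ?_
      rw [Fintype.card_prod, Fintype.card_bool, mul_comm]
  · intro y z hyz
    have hlt := ho y z hyz
    refine Finset.card_lt_card ⟨fun w hw => ?_, fun hsub => ?_⟩
    · simp only [Finset.mem_filter, Finset.mem_univ, true_and] at hw ⊢
      exact o.le_trans _ _ _ hw (@le_of_lt _ o.toPreorder _ _ hlt)
    · have hy : y ∈ Finset.univ.filter fun w => o.le w y := by simp
      have := hsub hy
      simp only [Finset.mem_filter, Finset.mem_univ, true_and] at this
      exact absurd hlt (@not_lt_of_ge _ o.toPreorder _ _ this)
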